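/- A \emph{semifield} is a set $\mathbb F$ with a commutative and associative addition and a multiplication that makes $\mathbb F$ an abelian group and distributes over the addition (there is no zero). Let $n\ge 1$ be an integer and $L=\{(x,y,t)\in\mathbb Z^3 : x+y+t\equiv n \bmod 2\}$. For $S\subset\mathbb R^3$ let $\mathcal H(S)=\mathbb F^{S\cap L}$ be the set of states of $S$, and let $P\mathcal H(S)=\mathcal H(S)/\mathbb F^\times$ be its quotient by the scaling action of $\mathbb F^\times=(\mathbb F,\cdot)$. For space-time $Y=I\times J\times\mathbb R$, with $I,J\subset\mathbb R$ closed intervals, the bounded octahedron recurrence is the rule $f(x,y,t+1)f(x,y,t-1)=N$, where $N=f(x+1,y,t)f(x-1,y,t)+f(x,y+1,t)f(x,y-1,t)$ if $x$ is interior to $I$ and $y$ is interior to $J$; $N=f(x+1,y,t)f(x-1,y,t)$ if $x$ is interior to $I$ and $y$ is an endpoint of $J$; $N=f(x,y+1,t)f(x,y-1,t)$ if $x$ is an endpoint of $I$ and $y$ is interior to $J$; and $N=f(x+\sigma,y,t)f(x,y+\tau,t)$ if both are endpoints, where $\sigma,\tau\in\{1,-1\}$ are the directions pointing into $I$ and $J$.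 Let $$A_1=\{(x,y,t)\in\mathbb R\times\mathbb R_{\ge0}\times\mathbb R : |x|+|y|+|t|\le n\},$$ $$A_2=\{(x,y,t)\in\mathbb R_{\ge0}\times[0,n]\times\mathbb R : x+y-n\le t\le y-x+n\},$$ with the recurrences of $Y_1=\mathbb R\times\mathbb R_{\ge0}\times\mathbb R$ and $Y_2=\mathbb R_{\ge0}\times[0,n]\times\mathbb R$ respectively. Their lower boundaries $S_i$ and upper boundaries $S_i'$ are $$S_1=\mathrm{conv}\{(n,0,0),(0,n,0),(0,0,-n)\}\cup\mathrm{conv}\{(-n,0,0),(0,n,0),(0,0,-n)\},$$ $$S_1'=\mathrm{conv}\{(n,0,0),(0,n,0),(0,0,n)\}\cup\mathrm{conv}\{(-n,0,0),(0,n,0),(0,0,n)\},$$ $$S_2=\mathrm{conv}\{(0,0,-n),(n,0,0),(0,n,0),(n,n,n)\},\qquad S_2'=\mathrm{conv}\{(n,0,0),(0,0,n),(n,n,n),(0,n,2n)\}.$$ Every state of $S_i$ extends uniquely to a solution of the recurrence on $A_i\cap L$; restricting this solution to $S_i'$ gives $\phi_i:\mathcal H(S_i)\to\mathcal H(S_i')$,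 which commutes with scaling and so induces $\overline\phi_i:P\mathcal H(S_i)\to P\mathcal H(S_i')$. Let $s:S_1\to S_2$ and $s':S_1'\to S_2'$ be the bijections that are affine on each of the two triangles of $S_1$, respectively $S_1'$, with $$s:\ (n,0,0)\mapsto(n,n,n),\ (0,n,0)\mapsto(0,n,0),\ (0,0,-n)\mapsto(n,0,0),\ (-n,0,0)\mapsto(0,0,-n),$$ $$s':\ (n,0,0)\mapsto(0,n,2n),\ (0,n,0)\mapsto(0,0,n),\ (0,0,n)\mapsto(n,n,n),\ (-n,0,0)\mapsto(n,0,0).$$ They send points of $L$ to points of $L$, and so induce pullbacks $s^*:P\mathcal H(S_2)\to P\mathcal H(S_1)$ and $s'^*:P\mathcal H(S_2')\to P\mathcal H(S_1')$. \textbf{Proposition.} For every semifield $\mathbb F$ and every integer $n\ge1$, the recurrences in $A_1$ and $A_2$ are equivalent up to scaling, in the sense that $$s'^*\circ\overline\phi_2=\overline\phi_1\circ s^*$$ as maps $P\mathcal H(S_2)\to P\mathcal H(S_1')$. -/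

import Mathlib

namespace OctRec

/-- A semifield in the sense of a set with a commutative and associative addition (without zero)
and a multiplication that makes it an abelian group and distributes over the addition. -/
class PosSemifield (F : Type*) extends CommGroup F, AddCommSemigroup F, Distrib F

/-! ### States and the bounded octahedron recurrence -/

/-- The points of `ℤ³` whose coordinate sum is congruent to `n` modulo `2`. -/
def lattice (n : ℤ) : Set (ℝ × ℝ × ℝ) :=
  {p | ∃ x y t : ℤ, p = ((x : ℝ), (y : ℝ), (t : ℝ)) ∧ Even (x + y + t - n)}

/-- The set `𝓗(A) = F ^ (A ∩ L)` of states of a subset `A` of space-time. -/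
abbrev State (n : ℤ) (A : Set (ℝ × ℝ × ℝ)) (F : Type*) : Type _ :=
  ↥(A ∩ lattice n) → F

/-- The projectivized states `P𝓗(A)`: the quotient of `𝓗(A)` by the scaling action of the
multiplicative group of `F`. -/
abbrev ProjState (n : ℤ) (A : Set (ℝ × ℝ × ℝ)) (F : Type*) [PosSemifield F] : Type _ :=
  MulAction.orbitRel.Quotient F (State n A F)

/-- Restriction of a state to a smaller subset. -/
def restrict {n : ℤ} {S A : Set (ℝ × ℝ × ℝ)} {F : Type*} (h : S ⊆ A) (f : State n A F) :
    State n S F :=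
  fun p => f ⟨p.1, h p.2.1, p.2.2⟩

/-- `f` satisfies the bounded octahedron recurrence in the subset `A` of the space-time
`Y = I × J × ℝ`, where `I` and `J` are intervals. There is one rule for the interior of the space
`I × J`, one rule for each kind of wall, and one for the corners, where `σ` and `τ` are the
directions that point from the corner into the space. The rules apply whenever all
the points that occur in them are lattice points of `A`. -/
structure IsRecurrent {F : Type*} [PosSemifield F] (n : ℤ) (I J : Set ℝ)
    (A : Set (ℝ × ℝ × ℝ)) (f : State n A F) : Prop where
  inner : ∀ x y t : ℝ, x ∈ interior I → y ∈ interior J →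
    ∀ (hu : (x, y, t + 1) ∈ A ∩ lattice n) (hd : (x, y, t - 1) ∈ A ∩ lattice n)
      (hx : (x + 1, y, t) ∈ A ∩ lattice n) (hx' : (x - 1, y, t) ∈ A ∩ lattice n)
      (hy : (x, y + 1, t) ∈ A ∩ lattice n) (hy' : (x, y - 1, t) ∈ A ∩ lattice n),
      f ⟨_, hu⟩ = (f ⟨_, hx⟩ * f ⟨_, hx'⟩ + f ⟨_, hy⟩ * f ⟨_, hy'⟩) / f ⟨_, hd⟩
  wall_y : ∀ x y t : ℝ, x ∈ interior I → y ∈ J \ interior J →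
    ∀ (hu : (x, y, t + 1) ∈ A ∩ lattice n) (hd : (x, y, t - 1) ∈ A ∩ lattice n)
      (hx : (x + 1, y, t) ∈ A ∩ lattice n) (hx' : (x - 1, y, t) ∈ A ∩ lattice n),
      f ⟨_, hu⟩ = f ⟨_, hx⟩ * f ⟨_, hx'⟩ / f ⟨_, hd⟩
  wall_x : ∀ x y t : ℝ, x ∈ I \ interior I → y ∈ interior J →
    ∀ (hu : (x, y, t + 1) ∈ A ∩ lattice n) (hd : (x, y, t - 1) ∈ A ∩ lattice n)
      (hy : (x, y + 1, t) ∈ A ∩ lattice n) (hy' : (x, y - 1, t) ∈ A ∩ lattice n),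
      f ⟨_, hu⟩ = f ⟨_, hy⟩ * f ⟨_, hy'⟩ / f ⟨_, hd⟩
  corner : ∀ x y t σ τ : ℝ, x ∈ I \ interior I → y ∈ J \ interior J →
    (σ = 1 ∨ σ = -1) → (τ = 1 ∨ τ = -1) → x + σ ∈ I → y + τ ∈ J →
    ∀ (hu : (x, y, t + 1) ∈ A ∩ lattice n) (hd : (x, y, t - 1) ∈ A ∩ lattice n)
      (hx : (x + σ, y, t) ∈ A ∩ lattice n) (hy : (x, y + τ, t) ∈ A ∩ lattice n),
      f ⟨_, hu⟩ = f ⟨_, hx⟩ * f ⟨_, hy⟩ / f ⟨_, hd⟩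

/-- Every state of `S` extends to exactly one solution of the recurrence in `A`. -/
def WellPosed (n : ℤ) (I J : Set ℝ) {A S : Set (ℝ × ℝ × ℝ)} (hS : S ⊆ A)
    (F : Type*) [PosSemifield F] : Prop :=
  ∀ g : State n S F, ∃! f : State n A F, IsRecurrent n I J A f ∧ restrict hS f = g

/-- The map `𝓗(S) → 𝓗(S')` induced by the recurrence in `A`: extend the state to `A` and
restrict it to `S'`. -/
noncomputable def evolution {n : ℤ} {I J : Set ℝ} {A S S' : Set (ℝ × ℝ × ℝ)} {hS : S ⊆ A}
    (hS' : S' ⊆ A) {F : Type*} [PosSemifield F] (h : WellPosed n I J hS F)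
    (g : State n S F) : State n S' F :=
  restrict hS' (h g).choose

theorem IsRecurrent.smul {F : Type*} [PosSemifield F] {n : ℤ} {I J : Set ℝ}
    {A : Set (ℝ × ℝ × ℝ)} {f : State n A F} (hf : IsRecurrent n I J A f) (c : F) :
    IsRecurrent n I J A (c • f) := by
  have key : ∀ a b e : F, c * (a * b / e) = (c * a) * (c * b) / (c * e) := by
    intro a b e
    rw [eq_div_iff_mul_eq', mul_mul_mul_comm, div_mul_cancel, mul_mul_mul_comm]
  have key2 : ∀ a b a' b' e : F, c * ((a * b + a' * b') / e) =
      ((c * a) * (c * b) + (c * a') * (c * b')) / (c * e) := by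
    intro a b a' b' e
    rw [eq_div_iff_mul_eq', mul_mul_mul_comm, div_mul_cancel, mul_mul_mul_comm c a,
      mul_mul_mul_comm c a', mul_add]
  refine ⟨?_, ?_, ?_, ?_⟩
  · intro x y t hI hJ hu hd hx hx' hy hy'
    simp only [Pi.smul_apply, smul_eq_mul, hf.inner x y t hI hJ hu hd hx hx' hy hy', key2]
  · intro x y t hI hJ hu hd hx hx'
    simp only [Pi.smul_apply, smul_eq_mul, hf.wall_y x y t hI hJ hu hd hx hx', key]
  · intro x y t hI hJ hu hd hy hy'
    simp only [Pi.smul_apply, smul_eq_mul, hf.wall_x x y t hI hJ hu hd hy hy', key]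
  · intro x y t σ τ hI hJ hσ hτ hxI hyJ hu hd hx hy
    simp only [Pi.smul_apply, smul_eq_mul,
      hf.corner x y t σ τ hI hJ hσ hτ hxI hyJ hu hd hx hy, key]

theorem evolution_smul {n : ℤ} {I J : Set ℝ} {A S S' : Set (ℝ × ℝ × ℝ)} {hS : S ⊆ A}
    (hS' : S' ⊆ A) {F : Type*} [PosSemifield F] (h : WellPosed n I J hS F)
    (c : F) (g : State n S F) : evolution hS' h (c • g) = c • evolution hS' h g := by
  have h1 := (h g).choose_spec.1
  have h2 : c • (h g).choose = (h (c • g)).choose := by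
    refine (h (c • g)).choose_spec.2 _ ⟨h1.1.smul c, ?_⟩
    funext p
    exact congrArg (fun a => c * a) (congrFun h1.2 p)
  unfold evolution
  rw [← h2]
  rfl

/-- The map `P𝓗(S) → P𝓗(S')` induced by the recurrence in `A`. -/
noncomputable def projEvolution {n : ℤ} {I J : Set ℝ} {A S S' : Set (ℝ × ℝ × ℝ)} {hS : S ⊆ A}
    (hS' : S' ⊆ A) {F : Type*} [PosSemifield F] (h : WellPosed n I J hS F) :
    ProjState n S F → ProjState n S' F :=
  Quotient.map (evolution hS' h) (by
    rintro a b ⟨c, hc⟩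
    exact ⟨c, by rw [← hc]; exact (evolution_smul hS' h c b).symm⟩)

/-- The pullback of states `𝓗(T) → 𝓗(S)` along a map `s : S → T` that sends lattice points
to lattice points. -/
def pullback {n : ℤ} {S T : Set (ℝ × ℝ × ℝ)} {F : Type*} (s : S → T)
    (hs : ∀ p : S, (p : ℝ × ℝ × ℝ) ∈ lattice n → (s p : ℝ × ℝ × ℝ) ∈ lattice n)
    (g : State n T F) : State n S F :=
  fun p => g ⟨s ⟨p.1, p.2.1⟩, (s ⟨p.1, p.2.1⟩).2, hs ⟨p.1, p.2.1⟩ p.2.2⟩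

/-- The pullback `P𝓗(T) → P𝓗(S)` of projectivized states. -/
def projPullback {n : ℤ} {S T : Set (ℝ × ℝ × ℝ)} {F : Type*} [PosSemifield F] (s : S → T)
    (hs : ∀ p : S, (p : ℝ × ℝ × ℝ) ∈ lattice n → (s p : ℝ × ℝ × ℝ) ∈ lattice n) :
    ProjState n T F → ProjState n S F :=
  Quotient.map (pullback s hs) (by
    rintro a b ⟨c, hc⟩
    exact ⟨c, by rw [← hc]; rfl⟩)

/-! ### Existence and uniqueness of solutions (auxiliary) -/

theorem lattice_shift {n : ℤ} {x y t : ℝ} (h : (x, y, t) ∈ lattice n) (a b c : ℤ)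
    (he : Even (a + b + c)) : (x + a, y + b, t + c) ∈ lattice n := by
  obtain ⟨i, j, k, hp, hev⟩ := h
  simp only [Prod.mk.injEq] at hp
  obtain ⟨rfl, rfl, rfl⟩ := hp
  refine ⟨i + a, j + b, k + c, by push_cast; rfl, ?_⟩
  rw [Int.even_iff] at *
  omega

/-- The right hand side of the recurrence, in terms of the two previous time slices. -/
noncomputable def ruleAux {F : Type*} [PosSemifield F] (I J : Set ℝ) (cur prev : ℝ → ℝ → F)
    (x y : ℝ) : F := by
  classical exact
    (if x ∈ interior I then
      if y ∈ interior J then cur (x + 1) y * cur (x - 1) y + cur x (y + 1) * cur x (y - 1)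
      else cur (x + 1) y * cur (x - 1) y
    else
      if y ∈ interior J then cur x (y + 1) * cur x (y - 1)
      else cur (if x + 1 ∈ I then x + 1 else x - 1) y *
        cur x (if y + 1 ∈ J then y + 1 else y - 1)) / prev x y

/-- The values of a solution at the times `k - n`, for natural numbers `k`. -/
noncomputable def sliceAux {F : Type*} [PosSemifield F] (n : ℤ) (I J : Set ℝ)
    (S : Set (ℝ × ℝ × ℝ)) (g : State n S F) : ℕ → ℝ → ℝ → F := by
  classical exact fun k => match k with
  | 0 => fun x y => if h : (x, y, ((0 : ℕ) : ℝ) - n) ∈ S ∩ lattice n then g ⟨_, h⟩ else 1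
  | 1 => fun x y => if h : (x, y, ((1 : ℕ) : ℝ) - n) ∈ S ∩ lattice n then g ⟨_, h⟩ else 1
  | (k + 2) => fun x y =>
      if h : (x, y, ((k + 2 : ℕ) : ℝ) - n) ∈ S ∩ lattice n then g ⟨_, h⟩ else
        ruleAux I J (sliceAux n I J S g (k + 1)) (sliceAux n I J S g k) x y

theorem sliceAux_of_mem {F : Type*} [PosSemifield F] (n : ℤ) (I J : Set ℝ)
    (S : Set (ℝ × ℝ × ℝ)) (g : State n S F) (k : ℕ) (x y : ℝ)
    (h : (x, y, (k : ℝ) - n) ∈ S ∩ lattice n) : sliceAux n I J S g k x y = g ⟨_, h⟩ := by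
  match k, h with
  | 0, h => rw [sliceAux]; exact dif_pos h
  | 1, h => rw [sliceAux]; exact dif_pos h
  | (k + 2), h => rw [sliceAux]; exact dif_pos h

theorem sliceAux_of_not_mem {F : Type*} [PosSemifield F] (n : ℤ) (I J : Set ℝ)
    (S : Set (ℝ × ℝ × ℝ)) (g : State n S F) (k : ℕ) (x y : ℝ)
    (h : (x, y, ((k + 2 : ℕ) : ℝ) - n) ∉ S ∩ lattice n) :
    sliceAux n I J S g (k + 2) x y =
      ruleAux I J (sliceAux n I J S g (k + 1)) (sliceAux n I J S g k) x y := by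
  rw [sliceAux]; exact dif_neg h

theorem mem_interior_of_neighbours {I : Set ℝ} (hI : I.OrdConnected) {x : ℝ}
    (h1 : x + 1 ∈ I) (h2 : x - 1 ∈ I) : x ∈ interior I := by
  rw [mem_interior_iff_mem_nhds]
  exact Filter.mem_of_superset (Icc_mem_nhds (by linarith) (by linarith)) (hI.out h2 h1)

theorem wellPosed_of {n : ℤ} {I J : Set ℝ} {A S : Set (ℝ × ℝ × ℝ)} (hS : S ⊆ A)
    (hI : I.OrdConnected) (hJ : J.OrdConnected)
    (hY : ∀ x y t : ℝ, (x, y, t) ∈ A → x ∈ I ∧ y ∈ J)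
    (hlow : ∀ x y t : ℝ, (x, y, t) ∈ A → -(n : ℝ) ≤ t)
    (hbot : ∀ x y t : ℝ, (x, y, t - 1) ∈ A → (x, y, t + 1) ∉ S)
    (hstep : ∀ x y t : ℝ, (x, y, t + 1) ∈ A ∩ lattice n → (x, y, t + 1) ∉ S →
      (x, y, t - 1) ∈ A ∧
      (x ∈ interior I → (x + 1, y, t) ∈ A ∧ (x - 1, y, t) ∈ A) ∧
      (x ∉ interior I → (x + 1, y, t) ∈ A ∨ (x - 1, y, t) ∈ A) ∧
      (y ∈ interior J → (x, y + 1, t) ∈ A ∧ (x, y - 1, t) ∈ A) ∧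
      (y ∉ interior J → (x, y + 1, t) ∈ A ∨ (x, y - 1, t) ∈ A))
    (F : Type*) [PosSemifield F] : WellPosed n I J hS F := by
  classical
  intro g
  have hfloor : ∀ k : ℕ, ⌊(k : ℝ) - n + n⌋₊ = k := fun k => by
    rw [sub_add_cancel, Nat.floor_natCast]
  have htime : ∀ x y t : ℝ, (x, y, t) ∈ A ∩ lattice n → ∃ k : ℕ, t = (k : ℝ) - n := by
    rintro x y t ⟨hA, i, j, k, hp, -⟩
    simp only [Prod.mk.injEq] at hp
    obtain ⟨rfl, rfl, rfl⟩ := hp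
    have := hlow _ _ _ hA
    have h0 : 0 ≤ k + n := by
      have : (0 : ℝ) ≤ ((k + n : ℤ) : ℝ) := by push_cast; linarith
      exact_mod_cast this
    refine ⟨(k + n).toNat, ?_⟩
    have : (((k + n).toNat : ℤ) : ℝ) = ((k + n : ℤ) : ℝ) := by rw [Int.toNat_of_nonneg h0]
    rw [Int.cast_natCast] at this
    rw [this]; push_cast; ring
  have hex : ∃ f : State n A F, IsRecurrent n I J A f ∧ restrict hS f = g := by
   refine ⟨fun p => sliceAux n I J S g ⌊p.1.2.2 + n⌋₊ p.1.1 p.1.2.1, ?_, ?_⟩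
   · have main : ∀ x y t : ℝ, (x, y, t + 1) ∈ A ∩ lattice n → (x, y, t - 1) ∈ A ∩ lattice n →
         sliceAux n I J S g ⌊t + 1 + n⌋₊ x y =
         ruleAux I J (sliceAux n I J S g ⌊t + n⌋₊) (sliceAux n I J S g ⌊t - 1 + n⌋₊) x y := by
       intro x y t hu hd
       obtain ⟨k, hk⟩ := htime _ _ _ hd
       have e1 : ⌊t - 1 + n⌋₊ = k := by rw [hk, hfloor]
       have e2 : ⌊t + n⌋₊ = k + 1 := by
         rw [← hfloor (k + 1)]; congr 1; push_cast; linarith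
       have e3 : ⌊t + 1 + n⌋₊ = k + 2 := by
         rw [← hfloor (k + 2)]; congr 1; push_cast; linarith
       rw [e1, e2, e3]
       apply sliceAux_of_not_mem
       intro h
       refine hbot x y t hd.1 ?_
       have : ((k + 2 : ℕ) : ℝ) - n = t + 1 := by push_cast; linarith
       rw [← this]
       exact h.1
     refine ⟨?_, ?_, ?_, ?_⟩
     · intro x y t hxI hyJ hu hd hx hx' hy hy'
       simp only [main x y t hu hd, ruleAux, if_pos hxI, if_pos hyJ]
     · intro x y t hxI hyJ hu hd hx hx'
       simp only [main x y t hu hd, ruleAux, if_pos hxI, if_neg hyJ.2]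
     · intro x y t hxI hyJ hu hd hy hy'
       simp only [main x y t hu hd, ruleAux, if_neg hxI.2, if_pos hyJ]
     · intro x y t σ τ hxI hyJ hσ hτ hσI hτJ hu hd hx hy
       have ex : (if x + 1 ∈ I then x + 1 else x - 1) = x + σ := by
         rcases hσ with rfl | rfl
         · rw [if_pos hσI]
         · rw [if_neg, sub_eq_add_neg]
           intro h
           exact hxI.2 (mem_interior_of_neighbours hI h (by rwa [sub_eq_add_neg]))
       have ey : (if y + 1 ∈ J then y + 1 else y - 1) = y + τ := by
         rcases hτ with rfl | rfl
         · rw [if_pos hτJ]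
         · rw [if_neg, sub_eq_add_neg]
           intro h
           exact hyJ.2 (mem_interior_of_neighbours hJ h (by rwa [sub_eq_add_neg]))
       simp only [main x y t hu hd, ruleAux, if_neg hxI.2, if_neg hyJ.2, ex, ey]
   · funext p
     obtain ⟨⟨x, y, t⟩, hp⟩ := p
     obtain ⟨k, rfl⟩ := htime _ _ _ ⟨hS hp.1, hp.2⟩
     simp only [restrict, hfloor]
     exact sliceAux_of_mem n I J S g k x y hp
  obtain ⟨f, hf, hfS⟩ := hex
  refine ⟨f, ⟨hf, hfS⟩, ?_⟩
  rintro f' ⟨hf', hfS'⟩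
  have main : ∀ k : ℕ, ∀ x y t : ℝ, ∀ h : (x, y, t) ∈ A ∩ lattice n, t = (k : ℝ) - n →
      f' ⟨_, h⟩ = f ⟨_, h⟩ := by
    intro k
    induction k using Nat.strong_induction_on with
    | _ k ih =>
    intro x y t' h hk
    by_cases hpS : (x, y, t') ∈ S
    · have h1 := congrFun hfS ⟨_, hpS, h.2⟩
      have h2 := congrFun hfS' ⟨_, hpS, h.2⟩
      exact h2.trans h1.symm
    obtain ⟨t, rfl⟩ : ∃ t, t' = t + 1 := ⟨t' - 1, by ring⟩
    obtain ⟨hdA, a1, a2, a3, a4⟩ := hstep x y t h hpS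
    have sh : ∀ a b : ℤ, ∀ c : ℤ, Even (a + b + (c - 1)) →
        (x + a, y + b, t + c) ∈ lattice n := by
      intro a b c he
      have := lattice_shift h.2 a b (c - 1) he
      convert this using 3
      push_cast; ring
    have hd : (x, y, t - 1) ∈ A ∩ lattice n := by
      refine ⟨hdA, ?_⟩
      have := sh 0 0 (-1) (by decide)
      simpa [sub_eq_add_neg] using this
    have l1 : (x + 1, y, t) ∈ lattice n := by simpa using sh 1 0 0 (by decide)
    have l2 : (x - 1, y, t) ∈ lattice n := by
      simpa [sub_eq_add_neg] using sh (-1) 0 0 (by decide)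
    have l3 : (x, y + 1, t) ∈ lattice n := by simpa using sh 0 1 0 (by decide)
    have l4 : (x, y - 1, t) ∈ lattice n := by
      simpa [sub_eq_add_neg] using sh 0 (-1) 0 (by decide)
    obtain ⟨j, hj⟩ := htime _ _ _ hd
    have hjk : k = j + 2 := by
      have : (k : ℝ) = ((j + 2 : ℕ) : ℝ) := by push_cast; linarith
      exact_mod_cast this
    have ed := ih j (by omega) _ _ _ hd hj
    have en : ∀ a b : ℝ, ∀ hn : (a, b, t) ∈ A ∩ lattice n, f' ⟨_, hn⟩ = f ⟨_, hn⟩ :=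
      fun a b hn => ih (j + 1) (by omega) a b t hn (by push_cast; linarith)
    obtain ⟨hxI, hyJ⟩ := hY _ _ _ h.1
    by_cases hx : x ∈ interior I <;> by_cases hy : y ∈ interior J
    · rw [hf.inner x y t hx hy h hd (Set.mem_inter (a1 hx).1 l1) (Set.mem_inter (a1 hx).2 l2) (Set.mem_inter (a3 hy).1 l3)
          (Set.mem_inter (a3 hy).2 l4),
        hf'.inner x y t hx hy h hd (Set.mem_inter (a1 hx).1 l1) (Set.mem_inter (a1 hx).2 l2) (Set.mem_inter (a3 hy).1 l3)
          (Set.mem_inter (a3 hy).2 l4), ed, en, en, en, en]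
    · rw [hf.wall_y x y t hx ⟨hyJ, hy⟩ h hd (Set.mem_inter (a1 hx).1 l1) (Set.mem_inter (a1 hx).2 l2),
        hf'.wall_y x y t hx ⟨hyJ, hy⟩ h hd (Set.mem_inter (a1 hx).1 l1) (Set.mem_inter (a1 hx).2 l2), ed, en, en]
    · rw [hf.wall_x x y t ⟨hxI, hx⟩ hy h hd (Set.mem_inter (a3 hy).1 l3) (Set.mem_inter (a3 hy).2 l4),
        hf'.wall_x x y t ⟨hxI, hx⟩ hy h hd (Set.mem_inter (a3 hy).1 l3) (Set.mem_inter (a3 hy).2 l4), ed, en, en]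
    · have b1 : ∃ σ : ℝ, (σ = 1 ∨ σ = -1) ∧ (x + σ, y, t) ∈ A ∩ lattice n := by
        rcases a2 hx with h' | h'
        · exact ⟨1, Or.inl rfl, h', l1⟩
        · exact ⟨-1, Or.inr rfl, by rw [← sub_eq_add_neg]; exact ⟨h', l2⟩⟩
      have b2 : ∃ τ : ℝ, (τ = 1 ∨ τ = -1) ∧ (x, y + τ, t) ∈ A ∩ lattice n := by
        rcases a4 hy with h' | h'
        · exact ⟨1, Or.inl rfl, h', l3⟩
        · exact ⟨-1, Or.inr rfl, by rw [← sub_eq_add_neg]; exact ⟨h', l4⟩⟩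
      obtain ⟨σ, hσ, hσA⟩ := b1
      obtain ⟨τ, hτ, hτA⟩ := b2
      rw [hf.corner x y t σ τ ⟨hxI, hx⟩ ⟨hyJ, hy⟩ hσ hτ (hY _ _ _ hσA.1).1
          (hY _ _ _ hτA.1).2 h hd hσA hτA,
        hf'.corner x y t σ τ ⟨hxI, hx⟩ ⟨hyJ, hy⟩ hσ hτ (hY _ _ _ hσA.1).1
          (hY _ _ _ hτA.1).2 h hd hσA hτA, ed, en, en]
  funext p
  obtain ⟨⟨x, y, t⟩, hp⟩ := p
  obtain ⟨k, hk⟩ := htime _ _ _ hp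
  exact main k x y t hp hk

/-! ### The half-octahedron and its boundaries -/

/-- The half-octahedron `A₁ = {|x| + |y| + |t| ≤ n}` in `Y₁ = ℝ × ℝ≥0 × ℝ`. -/
def A₁ (n : ℕ) : Set (ℝ × ℝ × ℝ) :=
  {p | p.1 ∈ Set.univ ∧ p.2.1 ∈ Set.Ici (0 : ℝ) ∧ |p.1| + |p.2.1| + |p.2.2| ≤ n}

/-- The lower boundary of `A₁`. -/
def S₁ (n : ℕ) : Set (ℝ × ℝ × ℝ) :=
  convexHull ℝ {((n : ℝ), (0 : ℝ), (0 : ℝ)), (0, (n : ℝ), 0), (0, 0, -(n : ℝ))} ∪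
    convexHull ℝ {(-(n : ℝ), (0 : ℝ), (0 : ℝ)), (0, (n : ℝ), 0), (0, 0, -(n : ℝ))}

/-- The upper boundary of `A₁`. -/
def S₁' (n : ℕ) : Set (ℝ × ℝ × ℝ) :=
  convexHull ℝ {((n : ℝ), (0 : ℝ), (0 : ℝ)), (0, (n : ℝ), 0), (0, 0, (n : ℝ))} ∪
    convexHull ℝ {(-(n : ℝ), (0 : ℝ), (0 : ℝ)), (0, (n : ℝ), 0), (0, 0, (n : ℝ))}

/-- The domain `A₂ = {x + y - n ≤ t ≤ y - x + n}` in `Y₂ = ℝ≥0 × [0, n] × ℝ`. -/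
def A₂ (n : ℕ) : Set (ℝ × ℝ × ℝ) :=
  {p | p.1 ∈ Set.Ici (0 : ℝ) ∧ p.2.1 ∈ Set.Icc (0 : ℝ) n ∧
    p.1 + p.2.1 - n ≤ p.2.2 ∧ p.2.2 ≤ p.2.1 - p.1 + n}

/-- The lower boundary of `A₂`. -/
def S₂ (n : ℕ) : Set (ℝ × ℝ × ℝ) :=
  convexHull ℝ {((0 : ℝ), (0 : ℝ), -(n : ℝ)), ((n : ℝ), 0, 0), (0, (n : ℝ), 0),
    ((n : ℝ), (n : ℝ), (n : ℝ))}

/-- The upper boundary of `A₂`. -/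
def S₂' (n : ℕ) : Set (ℝ × ℝ × ℝ) :=
  convexHull ℝ {((n : ℝ), (0 : ℝ), (0 : ℝ)), (0, 0, (n : ℝ)), ((n : ℝ), (n : ℝ), (n : ℝ)),
    (0, (n : ℝ), 2 * (n : ℝ))}

theorem mem_triangle (n : ℕ) {α β : ℝ} (hα : α = 1 ∨ α = -1) (hβ : β = 1 ∨ β = -1)
    (x y t : ℝ) :
    (x, y, t) ∈ convexHull ℝ {(α * (n : ℝ), (0 : ℝ), (0 : ℝ)), (0, (n : ℝ), 0),
      (0, 0, β * (n : ℝ))} ↔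
    0 ≤ α * x ∧ 0 ≤ y ∧ 0 ≤ β * t ∧ α * x + y + β * t = n := by
  have ha : α * α = 1 := by rcases hα with rfl | rfl <;> norm_num
  have hb : β * β = 1 := by rcases hβ with rfl | rfl <;> norm_num
  have hn : (0 : ℝ) ≤ n := Nat.cast_nonneg n
  constructor
  · intro h
    have hc : Convex ℝ {p : ℝ × ℝ × ℝ | 0 ≤ α * p.1 ∧ 0 ≤ p.2.1 ∧ 0 ≤ β * p.2.2 ∧
        α * p.1 + p.2.1 + β * p.2.2 = n} := by
      rintro ⟨a, b, c⟩ ⟨h1, h2, h3, h4⟩ ⟨a', b', c'⟩ ⟨h1', h2', h3', h4'⟩ u v hu hv huv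
      simp only [Set.mem_ofPred_eq, Prod.smul_mk, Prod.mk_add_mk, smul_eq_mul] at *
      refine ⟨?_, by positivity, ?_, ?_⟩
      · have := add_nonneg (mul_nonneg hu h1) (mul_nonneg hv h1'); linarith
      · have := add_nonneg (mul_nonneg hu h3) (mul_nonneg hv h3'); linarith
      · linear_combination u * h4 + v * h4' + (n : ℝ) * huv
    refine convexHull_min ?_ hc h
    rintro p (rfl | rfl | rfl) <;>
      simp only [Set.mem_ofPred_eq, ← mul_assoc, ha, hb] <;> norm_num
  · rintro ⟨h1, h2, h3, h4⟩
    rcases eq_or_lt_of_le hn with h0 | h0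
    · have e1 : α * x = 0 := by linarith
      have e2 : y = 0 := by linarith
      have e3 : β * t = 0 := by linarith
      have e1' : x = 0 := by linear_combination α * e1 - x * ha
      have e3' : t = 0 := by linear_combination β * e3 - t * hb
      rw [← h0, e1', e2, e3']
      apply subset_convexHull
      simp
    · have key := (convex_convexHull ℝ {(α * (n : ℝ), (0 : ℝ), (0 : ℝ)), (0, (n : ℝ), 0),
        (0, 0, β * (n : ℝ))}).sum_mem (t := (Finset.univ : Finset (Fin 3)))
        (w := ![α * x / n, y / n, β * t / n])
        (z := ![(α * (n : ℝ), (0 : ℝ), (0 : ℝ)), (0, (n : ℝ), 0), (0, 0, β * (n : ℝ))])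
        (by intro i _; fin_cases i <;> simp <;> positivity)
        (by
          simp only [Fin.sum_univ_three, Matrix.cons_val]
          rw [← add_div, ← add_div, h4, div_self h0.ne'])
        (by intro i _; apply subset_convexHull; fin_cases i <;> simp)
      simp only [Fin.sum_univ_three, Matrix.cons_val, Prod.smul_mk, Prod.mk_add_mk,
        smul_eq_mul, mul_zero, add_zero, zero_add] at key
      convert key using 2
      · field_simp
        linear_combination (-x) * ha
      · congr 1
        · field_simp
        · field_simp
          linear_combination (-t) * hb

theorem mem_S₁ (n : ℕ) (x y t : ℝ) :
    (x, y, t) ∈ S₁ n ↔ 0 ≤ y ∧ t ≤ 0 ∧ |x| + y - t = n := by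
  have h1 := mem_triangle n (Or.inl rfl) (Or.inr rfl) x y t
  have h2 := mem_triangle n (Or.inr rfl) (Or.inr rfl) x y t
  simp only [one_mul, neg_one_mul] at h1 h2
  rw [S₁, Set.mem_union, h1, h2]
  rcases abs_cases x with ⟨h, h'⟩ | ⟨h, h'⟩ <;> rw [h] <;> constructor
  · rintro (⟨a, b, c, d⟩ | ⟨a, b, c, d⟩) <;> exact ⟨b, by linarith, by linarith⟩
  · rintro ⟨a, b, c⟩; exact Or.inl ⟨h', a, by linarith, by linarith⟩
  · rintro (⟨a, b, c, d⟩ | ⟨a, b, c, d⟩) <;> exact ⟨b, by linarith, by linarith⟩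
  · rintro ⟨a, b, c⟩; exact Or.inr ⟨by linarith, a, by linarith, by linarith⟩

theorem mem_S₁' (n : ℕ) (x y t : ℝ) :
    (x, y, t) ∈ S₁' n ↔ 0 ≤ y ∧ 0 ≤ t ∧ |x| + y + t = n := by
  have h1 := mem_triangle n (Or.inl rfl) (Or.inl rfl) x y t
  have h2 := mem_triangle n (Or.inr rfl) (Or.inl rfl) x y t
  simp only [one_mul, neg_one_mul] at h1 h2
  rw [S₁', Set.mem_union, h1, h2]
  rcases abs_cases x with ⟨h, h'⟩ | ⟨h, h'⟩ <;> rw [h] <;> constructor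
  · rintro (⟨a, b, c, d⟩ | ⟨a, b, c, d⟩) <;> exact ⟨b, by linarith, by linarith⟩
  · rintro ⟨a, b, c⟩; exact Or.inl ⟨h', a, by linarith, by linarith⟩
  · rintro (⟨a, b, c, d⟩ | ⟨a, b, c, d⟩) <;> exact ⟨b, by linarith, by linarith⟩
  · rintro ⟨a, b, c⟩; exact Or.inr ⟨by linarith, a, by linarith, by linarith⟩

theorem mem_square (n : ℕ) (a b c : ℝ) (s : Set (ℝ × ℝ × ℝ))
    (hs : s = {((0 : ℝ), (0 : ℝ), c * n), ((n : ℝ), (0 : ℝ), (a + c) * n),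
      ((0 : ℝ), (n : ℝ), (b + c) * n), ((n : ℝ), (n : ℝ), (a + b + c) * n)}) (x y t : ℝ) :
    (x, y, t) ∈ convexHull ℝ s ↔
    0 ≤ x ∧ x ≤ n ∧ 0 ≤ y ∧ y ≤ n ∧ t = a * x + b * y + c * n := by
  have hn : (0 : ℝ) ≤ n := Nat.cast_nonneg n
  subst hs
  constructor
  · intro h
    have hc : Convex ℝ {p : ℝ × ℝ × ℝ | 0 ≤ p.1 ∧ p.1 ≤ n ∧ 0 ≤ p.2.1 ∧ p.2.1 ≤ n ∧
        p.2.2 = a * p.1 + b * p.2.1 + c * n} := by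
      rintro ⟨x1, y1, t1⟩ ⟨h1, h2, h3, h4, h5⟩ ⟨x2, y2, t2⟩ ⟨h1', h2', h3', h4', h5'⟩ u v hu hv
        huv
      simp only [Set.mem_ofPred_eq, Prod.smul_mk, Prod.mk_add_mk, smul_eq_mul] at *
      have e : (n : ℝ) = u * n + v * n := by rw [← add_mul, huv, one_mul]
      refine ⟨by positivity, ?_, by positivity, ?_, ?_⟩
      · rw [e]; gcongr
      · rw [e]; gcongr
      · linear_combination u * h5 + v * h5' + c * n * huv
    refine convexHull_min ?_ hc h
    rintro p (rfl | rfl | rfl | rfl) <;> simp only [Set.mem_ofPred_eq] <;>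
      refine ⟨by linarith, by linarith, by linarith, by linarith, by ring⟩
  · rintro ⟨h1, h2, h3, h4, h5⟩
    rcases eq_or_lt_of_le hn with h0 | h0
    · have e1 : x = 0 := by linarith
      have e2 : y = 0 := by linarith
      apply subset_convexHull
      left
      rw [h5, e1, e2]
      simp
    · have key := (convex_convexHull ℝ {((0 : ℝ), (0 : ℝ), c * (n : ℝ)),
          ((n : ℝ), (0 : ℝ), (a + c) * (n : ℝ)), ((0 : ℝ), (n : ℝ), (b + c) * (n : ℝ)),
          ((n : ℝ), (n : ℝ), (a + b + c) * (n : ℝ))}).sum_mem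
        (t := (Finset.univ : Finset (Fin 4)))
        (w := ![(1 - x / n) * (1 - y / n), (x / n) * (1 - y / n), (1 - x / n) * (y / n),
          (x / n) * (y / n)])
        (z := ![((0 : ℝ), (0 : ℝ), c * n), ((n : ℝ), (0 : ℝ), (a + c) * n),
          ((0 : ℝ), (n : ℝ), (b + c) * n), ((n : ℝ), (n : ℝ), (a + b + c) * n)])
        (by
          have i1 : 0 ≤ x / n := by positivity
          have i2 : 0 ≤ y / n := by positivity
          have i3 : 0 ≤ 1 - x / n := by rw [sub_nonneg, div_le_one h0]; exact h2
          have i4 : 0 ≤ 1 - y / n := by rw [sub_nonneg, div_le_one h0]; exact h4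
          intro i _
          fin_cases i
          · exact mul_nonneg i3 i4
          · exact mul_nonneg i1 i4
          · exact mul_nonneg i3 i2
          · exact mul_nonneg i1 i2)
        (by
          simp only [Fin.sum_univ_four, Matrix.cons_val]
          ring)
        (by intro i _; apply subset_convexHull; fin_cases i <;> simp)
      simp only [Fin.sum_univ_four, Matrix.cons_val, Prod.smul_mk, Prod.mk_add_mk,
        smul_eq_mul, mul_zero, add_zero, zero_add] at key
      convert key using 2
      · field_simp; ring
      · congr 1
        · field_simp; ring
        · rw [h5]; field_simp; ring

theorem mem_S₂ (n : ℕ) (x y t : ℝ) :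
    (x, y, t) ∈ S₂ n ↔ 0 ≤ x ∧ x ≤ n ∧ 0 ≤ y ∧ y ≤ n ∧ t = x + y - n := by
  rw [S₂, mem_square n 1 1 (-1)]
  · simp only [one_mul, neg_one_mul, sub_eq_add_neg]
  · norm_num

theorem mem_S₂' (n : ℕ) (x y t : ℝ) :
    (x, y, t) ∈ S₂' n ↔ 0 ≤ x ∧ x ≤ n ∧ 0 ≤ y ∧ y ≤ n ∧ t = y - x + n := by
  rw [S₂', mem_square n (-1) 1 1]
  · rw [show -1 * x + 1 * y + 1 * (n : ℝ) = y - x + n by ring]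
  · ext p
    norm_num
    tauto

theorem S₁_subset (n : ℕ) : S₁ n ⊆ A₁ n := by
  rintro ⟨x, y, t⟩ h
  rw [mem_S₁] at h
  refine ⟨trivial, h.1, ?_⟩
  simp only [abs_of_nonneg h.1, abs_of_nonpos h.2.1]
  linarith

theorem S₁'_subset (n : ℕ) : S₁' n ⊆ A₁ n := by
  rintro ⟨x, y, t⟩ h
  rw [mem_S₁'] at h
  refine ⟨trivial, h.1, ?_⟩
  simp only [abs_of_nonneg h.1, abs_of_nonneg h.2.1]
  linarith

theorem S₂_subset (n : ℕ) : S₂ n ⊆ A₂ n := by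
  rintro ⟨x, y, t⟩ h
  rw [mem_S₂] at h
  obtain ⟨h1, h2, h3, h4, h5⟩ := h
  exact ⟨h1, ⟨h3, h4⟩, by dsimp only; linarith, by dsimp only; linarith⟩

theorem S₂'_subset (n : ℕ) : S₂' n ⊆ A₂ n := by
  rintro ⟨x, y, t⟩ h
  rw [mem_S₂'] at h
  obtain ⟨h1, h2, h3, h4, h5⟩ := h
  exact ⟨h1, ⟨h3, h4⟩, by dsimp only; linarith, by dsimp only; linarith⟩

theorem mem_A₁ (n : ℕ) (x y t : ℝ) : (x, y, t) ∈ A₁ n ↔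
    0 ≤ y ∧ x + y + t ≤ n ∧ x + y - t ≤ n ∧ -x + y + t ≤ n ∧ -x + y - t ≤ n := by
  change (x ∈ Set.univ ∧ 0 ≤ y ∧ |x| + |y| + |t| ≤ n) ↔ _
  constructor
  · rintro ⟨-, h1, h2⟩
    rw [abs_of_nonneg h1] at h2
    have := le_abs_self x
    have := neg_le_abs x
    have := le_abs_self t
    have := neg_le_abs t
    refine ⟨h1, by linarith, by linarith, by linarith, by linarith⟩
  · rintro ⟨h1, h2, h3, h4, h5⟩
    refine ⟨trivial, h1, ?_⟩
    rw [abs_of_nonneg h1]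
    rcases abs_cases x with ⟨h, -⟩ | ⟨h, -⟩ <;> rcases abs_cases t with ⟨h', -⟩ | ⟨h', -⟩ <;>
      rw [h, h'] <;> linarith

theorem mem_A₂ (n : ℕ) (x y t : ℝ) : (x, y, t) ∈ A₂ n ↔
    0 ≤ x ∧ 0 ≤ y ∧ y ≤ n ∧ x + y - n ≤ t ∧ t ≤ y - x + n := by
  change (0 ≤ x ∧ (0 ≤ y ∧ y ≤ n) ∧ x + y - n ≤ t ∧ t ≤ y - x + n) ↔ _
  tauto

theorem wellPosed₁ (n : ℕ) (F : Type*) [PosSemifield F] :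
    WellPosed (n : ℤ) Set.univ (Set.Ici 0) (S₁_subset n) F := by
  apply wellPosed_of (S₁_subset n) Set.ordConnected_univ Set.ordConnected_Ici
  · intro x y t h
    exact ⟨h.1, h.2.1⟩
  · intro x y t h
    rw [mem_A₁] at h
    push_cast
    linarith
  · intro x y t h h'
    rw [mem_A₁] at h
    rw [mem_S₁] at h'
    rcases abs_cases x with ⟨e, -⟩ | ⟨e, -⟩ <;> rw [e] at h' <;> linarith
  · rintro x y t ⟨h, i, j, k, hp, hev⟩ hS
    simp only [Prod.mk.injEq] at hp
    obtain ⟨rfl, rfl, hk⟩ := hp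
    rw [hk] at h hS
    obtain rfl : t = (k : ℝ) - 1 := by linarith
    rw [Int.even_iff] at hev
    have cast : ∀ a b c : ℤ, ((a : ℝ), (b : ℝ), (c : ℝ)) ∈ A₁ n ↔
        0 ≤ b ∧ a + b + c ≤ n ∧ a + b - c ≤ n ∧ -a + b + c ≤ n ∧ -a + b - c ≤ n := by
      intro a b c
      rw [mem_A₁]
      norm_cast
    have h' := (cast i j k).1 h
    have hS' : ¬ (0 ≤ j ∧ k ≤ 0 ∧ |i| + j - k = n) := by
      intro h0; apply hS; rw [mem_S₁]; exact_mod_cast h0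
    have hS1 : i + j - k ≠ n ∧ -i + j - k ≠ n := by
      rcases abs_cases i with ⟨e, e'⟩ | ⟨e, e'⟩ <;> rw [e] at hS' <;> omega
    have g0 := (cast i j (k - 2)).2
    have g1 := (cast (i + 1) j (k - 1)).2
    have g2 := (cast (i - 1) j (k - 1)).2
    have g3 := (cast i (j + 1) (k - 1)).2
    have g4 := (cast i (j - 1) (k - 1)).2
    push_cast at g0 g1 g2 g3 g4
    rw [sub_sub, one_add_one_eq_two, interior_univ, interior_Ici]
    have e2 : (j : ℝ) ∈ Set.Ioi (0 : ℝ) ↔ 0 < j := by simp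
    rw [e2]
    clear hS hS' cast hk h e2
    refine ⟨g0 (by omega), fun _ => ⟨g1 (by omega), g2 (by omega)⟩,
      fun h => absurd trivial h, fun hj => ⟨g3 (by omega), g4 (by omega)⟩,
      fun hj => Or.inl (g3 (by omega))⟩

theorem wellPosed₂ (n : ℕ) (F : Type*) [PosSemifield F] :
    WellPosed (n : ℤ) (Set.Ici 0) (Set.Icc 0 (n : ℝ)) (S₂_subset n) F := by
  apply wellPosed_of (S₂_subset n) Set.ordConnected_Ici Set.ordConnected_Icc
  · intro x y t h
    exact ⟨h.1, h.2.1⟩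
  · intro x y t h
    rw [mem_A₂] at h
    push_cast
    linarith
  · intro x y t h h'
    rw [mem_A₂] at h
    rw [mem_S₂] at h'
    linarith
  · rintro x y t ⟨h, i, j, k, hp, hev⟩ hS
    simp only [Prod.mk.injEq] at hp
    obtain ⟨rfl, rfl, hk⟩ := hp
    rw [hk] at h hS
    obtain rfl : t = (k : ℝ) - 1 := by linarith
    rw [Int.even_iff] at hev
    have cast : ∀ a b c : ℤ, ((a : ℝ), (b : ℝ), (c : ℝ)) ∈ A₂ n ↔
        0 ≤ a ∧ 0 ≤ b ∧ b ≤ n ∧ a + b - n ≤ c ∧ c ≤ b - a + n := by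
      intro a b c
      rw [mem_A₂]
      norm_cast
    have h' := (cast i j k).1 h
    have hS' : ¬ (0 ≤ i ∧ i ≤ n ∧ 0 ≤ j ∧ j ≤ n ∧ k = i + j - n) := by
      intro h0; apply hS; rw [mem_S₂]; exact_mod_cast h0
    have hS1 : i + j - n + 2 ≤ k := by omega
    have g0 := (cast i j (k - 2)).2
    have g1 := (cast (i + 1) j (k - 1)).2
    have g2 := (cast (i - 1) j (k - 1)).2
    have g3 := (cast i (j + 1) (k - 1)).2
    have g4 := (cast i (j - 1) (k - 1)).2
    push_cast at g0 g1 g2 g3 g4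
    rw [sub_sub, one_add_one_eq_two, interior_Ici, interior_Icc]
    have e1 : (i : ℝ) ∈ Set.Ioi (0 : ℝ) ↔ 0 < i := by simp
    have e2 : (j : ℝ) ∈ Set.Ioo (0 : ℝ) n ↔ 0 < j ∧ j < n := by
      rw [Set.mem_Ioo]; norm_cast
    rw [e1, e2]
    clear hS hS' hev cast hk h e1 e2
    refine ⟨g0 (by omega), fun hi => ⟨g1 (by omega), g2 (by omega)⟩,
      fun hi => Or.inl (g1 (by omega)), fun hj => ⟨g3 (by omega), g4 (by omega)⟩, fun hj => ?_⟩
    by_cases h : j = 0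
    · exact Or.inl (g3 (by omega))
    · exact Or.inr (g4 (by omega))

/-- The map `φ̄₁ : P𝓗(S₁) → P𝓗(S₁')` induced by the recurrence in `A₁`. -/
noncomputable def projPhi₁ (n : ℕ) (F : Type*) [PosSemifield F] :
    ProjState n (S₁ n) F → ProjState n (S₁' n) F :=
  projEvolution (S₁'_subset n) (wellPosed₁ n F)

/-- The map `φ̄₂ : P𝓗(S₂) → P𝓗(S₂')` induced by the recurrence in `A₂`. -/
noncomputable def projPhi₂ (n : ℕ) (F : Type*) [PosSemifield F] :
    ProjState n (S₂ n) F → ProjState n (S₂' n) F :=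
  projEvolution (S₂'_subset n) (wellPosed₂ n F)

/-! ### The identifications of the boundaries -/

open Classical in
/-- The map `s : S₁ → S₂`. It is linear on each of the two triangles `0 ≤ x` and `x ≤ 0` of `S₁`;
the values at the vertices are given in `s_vertices` below. -/
noncomputable def sFun (p : ℝ × ℝ × ℝ) : ℝ × ℝ × ℝ :=
  if 0 ≤ p.1 then (p.1 - p.2.2, p.1 + p.2.1, p.1) else (-p.2.2, p.2.1, p.1)

open Classical in
/-- The map `s' : S₁' → S₂'`. It is linear on each of the two triangles `0 ≤ x` and `x ≤ 0` of
`S₁'`; the values at the vertices are given in `s'_vertices` below. -/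
noncomputable def sFun' (p : ℝ × ℝ × ℝ) : ℝ × ℝ × ℝ :=
  if 0 ≤ p.1 then (p.2.2, p.1 + p.2.2, 2 * p.1 + p.2.1 + p.2.2)
  else (p.2.2 - p.1, p.2.2, p.2.1 + p.2.2)

theorem sFun_of_nonneg {x : ℝ} (hx : 0 ≤ x) (y t : ℝ) : sFun (x, y, t) = (x - t, x + y, x) :=
  if_pos hx

theorem sFun_of_nonpos {x : ℝ} (hx : x ≤ 0) (y t : ℝ) : sFun (x, y, t) = (-t, y, x) := by
  rcases eq_or_lt_of_le hx with rfl | h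
  · rw [sFun_of_nonneg le_rfl, zero_sub, zero_add]
  · exact if_neg (not_le.2 h)

theorem sFun'_of_nonneg {x : ℝ} (hx : 0 ≤ x) (y t : ℝ) :
    sFun' (x, y, t) = (t, x + t, 2 * x + y + t) :=
  if_pos hx

theorem sFun'_of_nonpos {x : ℝ} (hx : x ≤ 0) (y t : ℝ) :
    sFun' (x, y, t) = (t - x, t, y + t) := by
  rcases eq_or_lt_of_le hx with rfl | h
  · rw [sFun'_of_nonneg le_rfl, sub_zero, zero_add, mul_zero, zero_add]
  · exact if_neg (not_le.2 h)

theorem s_vertices (n : ℕ) :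
    sFun ((n : ℝ), 0, 0) = ((n : ℝ), (n : ℝ), (n : ℝ)) ∧
    sFun (0, (n : ℝ), 0) = (0, (n : ℝ), 0) ∧
    sFun (0, 0, -(n : ℝ)) = ((n : ℝ), 0, 0) ∧
    sFun (-(n : ℝ), 0, 0) = (0, 0, -(n : ℝ)) := by
  have hn : (0 : ℝ) ≤ n := Nat.cast_nonneg n
  rw [sFun_of_nonneg hn, sFun_of_nonneg le_rfl, sFun_of_nonneg le_rfl,
    sFun_of_nonpos (neg_nonpos.2 hn)]
  simp

theorem s'_vertices (n : ℕ) :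
    sFun' ((n : ℝ), 0, 0) = (0, (n : ℝ), 2 * (n : ℝ)) ∧
    sFun' (0, (n : ℝ), 0) = (0, 0, (n : ℝ)) ∧
    sFun' (0, 0, (n : ℝ)) = ((n : ℝ), (n : ℝ), (n : ℝ)) ∧
    sFun' (-(n : ℝ), 0, 0) = ((n : ℝ), 0, 0) := by
  have hn : (0 : ℝ) ≤ n := Nat.cast_nonneg n
  rw [sFun'_of_nonneg hn, sFun'_of_nonneg le_rfl, sFun'_of_nonneg le_rfl,
    sFun'_of_nonpos (neg_nonpos.2 hn)]
  simp

/-- The identification `s : S₁ → S₂` of the lower boundaries. -/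
noncomputable def s (n : ℕ) : S₁ n ≃ S₂ n where
  toFun p := ⟨sFun p, by
    obtain ⟨⟨x, y, t⟩, h⟩ := p
    rw [mem_S₁] at h
    rcases le_total 0 x with hx | hx
    · rw [sFun_of_nonneg hx, mem_S₂]
      rw [abs_of_nonneg hx] at h
      refine ⟨?_, ?_, ?_, ?_, ?_⟩ <;> linarith
    · rw [sFun_of_nonpos hx, mem_S₂]
      rw [abs_of_nonpos hx] at h
      refine ⟨?_, ?_, ?_, ?_, ?_⟩ <;> linarith⟩
  invFun p := ⟨(p.1.2.2, p.1.2.1 - max p.1.2.2 0, max p.1.2.2 0 - p.1.1), by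
    obtain ⟨⟨x, y, t⟩, h⟩ := p
    rw [mem_S₂] at h
    rw [mem_S₁]
    dsimp only
    rcases le_total 0 t with ht | ht
    · rw [abs_of_nonneg ht, max_eq_left ht]
      refine ⟨?_, ?_, ?_⟩ <;> linarith
    · rw [abs_of_nonpos ht, max_eq_right ht]
      refine ⟨?_, ?_, ?_⟩ <;> linarith⟩
  left_inv := by
    rintro ⟨⟨x, y, t⟩, h⟩
    apply Subtype.ext
    dsimp only
    rcases le_total 0 x with hx | hx
    · rw [sFun_of_nonneg hx]; simp [hx]
    · rw [sFun_of_nonpos hx]; simp [hx]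
  right_inv := by
    rintro ⟨⟨x, y, t⟩, h⟩
    apply Subtype.ext
    dsimp only
    rcases le_total 0 t with hx | hx
    · rw [sFun_of_nonneg hx]; simp [hx]
    · rw [sFun_of_nonpos hx]; simp [hx]

/-- The identification `s' : S₁' → S₂'` of the upper boundaries. -/
noncomputable def s' (n : ℕ) : S₁' n ≃ S₂' n where
  toFun p := ⟨sFun' p, by
    obtain ⟨⟨x, y, t⟩, h⟩ := p
    rw [mem_S₁'] at h
    rcases le_total 0 x with hx | hx
    · rw [sFun'_of_nonneg hx, mem_S₂']
      rw [abs_of_nonneg hx] at h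
      refine ⟨?_, ?_, ?_, ?_, ?_⟩ <;> linarith
    · rw [sFun'_of_nonpos hx, mem_S₂']
      rw [abs_of_nonpos hx] at h
      refine ⟨?_, ?_, ?_, ?_, ?_⟩ <;> linarith⟩
  invFun p := ⟨(p.1.2.1 - p.1.1, n - |p.1.2.1 - p.1.1| - min p.1.1 p.1.2.1,
      min p.1.1 p.1.2.1), by
    obtain ⟨⟨x, y, t⟩, h⟩ := p
    rw [mem_S₂'] at h
    rw [mem_S₁']
    dsimp only
    rcases le_total x y with hx | hx
    · rw [abs_of_nonneg (sub_nonneg.2 hx), min_eq_left hx]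
      refine ⟨?_, ?_, ?_⟩ <;> linarith
    · rw [abs_of_nonpos (sub_nonpos.2 hx), min_eq_right hx]
      refine ⟨?_, ?_, ?_⟩ <;> linarith⟩
  left_inv := by
    rintro ⟨⟨x, y, t⟩, h⟩
    apply Subtype.ext
    rw [mem_S₁'] at h
    dsimp only
    rcases le_total 0 x with hx | hx
    · rw [sFun'_of_nonneg hx]
      rw [abs_of_nonneg hx] at h
      dsimp only
      rw [min_eq_left (by linarith), add_sub_cancel_right, abs_of_nonneg hx,
        ← h.2.2]
      ring_nf
    · rw [sFun'_of_nonpos hx]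
      rw [abs_of_nonpos hx] at h
      dsimp only
      rw [min_eq_right (by linarith), show t - (t - x) = x by ring, abs_of_nonpos hx,
        ← h.2.2]
      ring_nf
  right_inv := by
    rintro ⟨⟨x, y, t⟩, h⟩
    apply Subtype.ext
    rw [mem_S₂'] at h
    dsimp only
    rcases le_total x y with hx | hx
    · rw [sFun'_of_nonneg (sub_nonneg.2 hx), min_eq_left hx, abs_of_nonneg (sub_nonneg.2 hx),
        h.2.2.2.2]
      ring_nf
    · rw [sFun'_of_nonpos (sub_nonpos.2 hx), min_eq_right hx, abs_of_nonpos (sub_nonpos.2 hx),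
        h.2.2.2.2]
      ring_nf

theorem s_lattice (n : ℕ) (p : S₁ n) (h : (p : ℝ × ℝ × ℝ) ∈ lattice n) :
    (s n p : ℝ × ℝ × ℝ) ∈ lattice n := by
  obtain ⟨p, hp⟩ := p
  obtain ⟨x, y, t, rfl, hev⟩ := h
  change sFun _ ∈ _
  rw [Int.even_iff] at hev
  rcases le_total (0 : ℝ) x with hx | hx
  · rw [sFun_of_nonneg hx]
    exact ⟨x - t, x + y, x, by push_cast; rfl, by rw [Int.even_iff]; omega⟩
  · rw [sFun_of_nonpos hx]
    exact ⟨-t, y, x, by push_cast; rfl, by rw [Int.even_iff]; omega⟩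

theorem s'_lattice (n : ℕ) (p : S₁' n) (h : (p : ℝ × ℝ × ℝ) ∈ lattice n) :
    (s' n p : ℝ × ℝ × ℝ) ∈ lattice n := by
  obtain ⟨p, hp⟩ := p
  obtain ⟨x, y, t, rfl, hev⟩ := h
  change sFun' _ ∈ _
  rw [Int.even_iff] at hev
  rcases le_total (0 : ℝ) x with hx | hx
  · rw [sFun'_of_nonneg hx]
    exact ⟨t, x + t, 2 * x + y + t, by push_cast; rfl, by rw [Int.even_iff]; omega⟩
  · rw [sFun'_of_nonpos hx]
    exact ⟨t - x, t, y + t, by push_cast; rfl, by rw [Int.even_iff]; omega⟩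

/-- The pullback `s* : P𝓗(S₂) → P𝓗(S₁)`. -/
noncomputable def sPull (n : ℕ) (F : Type*) [PosSemifield F] :
    ProjState n (S₂ n) F → ProjState n (S₁ n) F :=
  projPullback (s n) (s_lattice n)

/-- The pullback `s'* : P𝓗(S₂') → P𝓗(S₁')`. -/
noncomputable def sPull' (n : ℕ) (F : Type*) [PosSemifield F] :
    ProjState n (S₂' n) F → ProjState n (S₁' n) F :=
  projPullback (s' n) (s'_lattice n)

end OctRec

/-! Over a field, both recurrences are solved by maximal minors of one matrix; a universal semifield
then carries the resulting identity to every semifield.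

On the wall `y = 0` of the half-octahedron the recurrence forces the values to be a function of `i`
times a function of `j` (`wall_eq`), so a gauge transformation normalizes them to one. The
recurrence in `A₁` is then Dodgson condensation: its values are, up to sign, the contiguous minors
of an `n × n` matrix `M`, hence maximal minors of the matrix `(± 1 | M | 1)` with columns `v k`, `-n
≤ k < 2n` (`IsHalfOctSolution.eq_listDet`). The recurrence in `A₂` is solved by the maximal minors
on two blocks of consecutive columns, `[a - (n - y), a)` and `[a + x, a + x + y)`
(`prism_determinants`). The interior rules are both instances of the three-term Plücker relation.

The outer blocks are related by `v k = (-1)^(n-1) v (k + 2n)`. This is the sign of moving a column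
from the front of a maximal minor to its end, so columns with negative index can be traded for
columns of the right identity block. After this rotation the two families of minors coincide on the
lower boundaries, which makes the determinants the solution in `A₂`, and they coincide again on the
upper boundaries. Undoing the gauge leaves one constant, the ratio of the initial values at `(0, 0,
-n)` and `(-n, 0, 0)`; this is why the equality holds only up to scaling.

A semifield need not embed in a field. Instead, `valueSubgroup g` consists of subtraction-free
rational functions in the initial values, each paired with its value at `g`. It embeds in a field of
rational functions, where the determinant argument applies, and it maps to `F` by a homomorphism
sending the coordinates to `g`. Solutions are unique, so they commute with homomorphisms, and the
identity descends to `F`. -/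

namespace OctRec

/-! ### Determinants of lists of vectors and the three-term Plücker relation -/

section Determinants

variable {K : Type*} [Field K] {n : ℕ}

/-- The linear functional on the exterior algebra of `Kⁿ` that is the determinant in degree `n`
and vanishes in the other degrees. -/
noncomputable def topForm (K : Type*) [Field K] (n : ℕ) : ExteriorAlgebra K (Fin n → K) →ₗ[K] K :=
  ExteriorAlgebra.liftAlternating (Pi.single n Matrix.detRowAlternating)

/-- The determinant of a list of `n` vectors of `Kⁿ`. -/
noncomputable def listDet (l : List (Fin n → K)) : K :=
  topForm K n (l.map (ExteriorAlgebra.ι K)).prod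

theorem listDet_ofFn (m : Fin n → Fin n → K) :
    listDet (List.ofFn m) = Matrix.det (Matrix.of m) := by
  have h := ExteriorAlgebra.liftAlternating_apply_ιMulti (R := K)
    (Pi.single n Matrix.detRowAlternating) m
  rw [ExteriorAlgebra.ιMulti_apply, Pi.single_eq_same] at h
  rw [listDet, List.map_ofFn]
  exact h

/-- Vectors anticommute in the exterior algebra. Working there reduces the movement of a vector past
a block to one sign, with no bookkeeping of permutations of indices. -/
theorem prod_mul_ι (l : List (Fin n → K)) (v : Fin n → K) :
    (l.map (ExteriorAlgebra.ι K)).prod * ExteriorAlgebra.ι K v =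
      (-1 : K) ^ l.length • (ExteriorAlgebra.ι K v * (l.map (ExteriorAlgebra.ι K)).prod) := by
  induction l with
  | nil => simp
  | cons w l ih =>
    have h : ExteriorAlgebra.ι K w * ExteriorAlgebra.ι K v =
        -(ExteriorAlgebra.ι K v * ExteriorAlgebra.ι K w) :=
      eq_neg_of_add_eq_zero_left (ExteriorAlgebra.ι_add_mul_swap w v)
    rw [List.map_cons, List.prod_cons, mul_assoc, ih, mul_smul_comm, ← mul_assoc, h, neg_mul,
      smul_neg, mul_assoc, List.length_cons, pow_succ, mul_neg_one, neg_smul]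

theorem listDet_move (l₁ l₂ l₃ : List (Fin n → K)) (v : Fin n → K) :
    listDet (l₁ ++ (l₂ ++ v :: l₃)) = (-1) ^ l₂.length * listDet (l₁ ++ v :: (l₂ ++ l₃)) := by
  simp only [listDet, List.map_append, List.map_cons, List.prod_append, List.prod_cons]
  rw [← mul_assoc _ (ExteriorAlgebra.ι K v) (List.map _ l₃).prod, prod_mul_ι]
  simp only [smul_mul_assoc, mul_smul_comm, map_smul, smul_eq_mul, mul_assoc]

theorem listDet_smul (l₁ l₂ : List (Fin n → K)) (c : K) (v : Fin n → K) :
    listDet (l₁ ++ c • v :: l₂) = c * listDet (l₁ ++ v :: l₂) := by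
  simp only [listDet, List.map_append, List.map_cons, List.prod_append, List.prod_cons, map_smul,
    smul_mul_assoc, mul_smul_comm, smul_eq_mul]

/-- Cramer's rule expands `det m • s` in the rows `p, q, c` of `m`. Applying the linear functional
`det (·, r, c)` kills the rows from `c`, and the rows `p` and `q` give the two terms on the right.
-/
theorem det_cons_cons_plucker {k : ℕ} (c : Fin k → Fin (k + 2) → K) (p q r s : Fin (k + 2) → K) :
    (Matrix.of (Fin.cons p (Fin.cons q c : Fin (k + 1) → _) : Fin (k + 2) → _)).det *
      (Matrix.of (Fin.cons s (Fin.cons r c : Fin (k + 1) → _) : Fin (k + 2) → _)).det =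
    (Matrix.of (Fin.cons s (Fin.cons q c : Fin (k + 1) → _) : Fin (k + 2) → _)).det *
      (Matrix.of (Fin.cons p (Fin.cons r c : Fin (k + 1) → _) : Fin (k + 2) → _)).det +
    (Matrix.of (Fin.cons p (Fin.cons s c : Fin (k + 1) → _) : Fin (k + 2) → _)).det *
      (Matrix.of (Fin.cons q (Fin.cons r c : Fin (k + 1) → _) : Fin (k + 2) → _)).det := by
  set m : Matrix (Fin (k + 2)) (Fin (k + 2)) K :=
    Matrix.of (Fin.cons p (Fin.cons q c : Fin (k + 1) → _) : Fin (k + 2) → _) with hm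
  let D : (Fin (k + 2) → K) →ₗ[K] K :=
    (Matrix.detRowAlternating (R := K) (n := Fin (k + 2))).toMultilinearMap.toLinearMap
      (Fin.cons 0 (Fin.cons r c : Fin (k + 1) → _) : Fin (k + 2) → _) 0
  have hD : ∀ w, D w =
      (Matrix.of (Fin.cons w (Fin.cons r c : Fin (k + 1) → _) : Fin (k + 2) → _)).det := by
    intro w
    simp only [D, MultilinearMap.toLinearMap_apply, Fin.update_cons_zero]
    rfl
  have h := Matrix.mulVec_cramer m.transpose s
  have h2 : ∑ i, (m.updateRow i s).det • m i = m.det • s := by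
    rw [← Matrix.det_transpose m, ← h]
    ext j
    simp [Matrix.mulVec, dotProduct, Finset.sum_apply, Matrix.cramer_transpose_apply, mul_comm]
  have h3 := congrArg D h2
  rw [map_sum, map_smul, Fin.sum_univ_succ, Fin.sum_univ_succ] at h3
  have hz : ∀ i : Fin k, D (m i.succ.succ) = 0 := by
    intro i
    rw [hD]
    apply Matrix.det_zero_of_row_eq (i := 0) (j := i.succ.succ) (Fin.succ_ne_zero _).symm
    rfl
  simp only [map_smul, hz, smul_eq_mul, mul_zero, Finset.sum_const_zero, add_zero] at h3
  rw [hD, hD, hD] at h3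
  have e0 : m.updateRow 0 s =
      Matrix.of (Fin.cons s (Fin.cons q c : Fin (k + 1) → _) : Fin (k + 2) → _) :=
    Fin.update_cons_zero (α := fun _ => Fin (k + 2) → K) p (Fin.cons q c : Fin (k + 1) → _) s
  have e1 : m.updateRow (Fin.succ 0) s =
      Matrix.of (Fin.cons p (Fin.cons s c : Fin (k + 1) → _) : Fin (k + 2) → _) := by
    have := Fin.cons_update (α := fun _ => Fin (k + 2) → K) p (Fin.cons q c : Fin (k + 1) → _) 0 s
    rw [Fin.update_cons_zero] at this
    exact this.symm
  rw [e0, e1] at h3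
  rw [← h3]
  rfl

theorem listDet_plucker (l : List (Fin n → K)) (hl : l.length + 2 = n) (p q r s : Fin n → K) :
    listDet (p :: q :: l) * listDet (s :: r :: l) =
      listDet (s :: q :: l) * listDet (p :: r :: l) +
        listDet (p :: s :: l) * listDet (q :: r :: l) := by
  obtain ⟨k, rfl⟩ : ∃ k, n = k + 2 := ⟨_, hl.symm⟩
  obtain ⟨c, rfl⟩ : ∃ c : Fin k → Fin (k + 2) → K, l = List.ofFn c :=
    ⟨fun i => l.get (i.cast (by omega)), by
      rw [List.ofFn_congr (show k = l.length by omega)]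
      exact (List.ofFn_get l).symm⟩
  have h : ∀ a b, listDet (a :: b :: List.ofFn c) =
      (Matrix.of (Fin.cons a (Fin.cons b c : Fin (k + 1) → _) : Fin (k + 2) → _)).det := by
    intro a b
    rw [← listDet_ofFn, List.ofFn_cons, List.ofFn_cons]
  simp only [h]
  exact det_cons_cons_plucker _ p q r s

end Determinants

/-! ### Blocks of consecutive terms of a sequence -/

section Segments

/-- The list of `l` consecutive terms of a sequence, starting with the term of index `s`. -/
def seg {M : Type*} (v : ℤ → M) (s : ℤ) : ℕ → List M
  | 0 => []
  | l + 1 => v s :: seg v (s + 1) l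

variable {M : Type*} (v : ℤ → M)

@[simp] theorem seg_zero (s : ℤ) : seg v s 0 = [] := rfl

theorem seg_succ (s : ℤ) (l : ℕ) : seg v s (l + 1) = v s :: seg v (s + 1) l := rfl

@[simp] theorem length_seg (s : ℤ) (l : ℕ) : (seg v s l).length = l := by
  induction l generalizing s with
  | zero => rfl
  | succ l ih => rw [seg_succ, List.length_cons, ih]

theorem seg_add (s : ℤ) (k l : ℕ) : seg v s (k + l) = seg v s k ++ seg v (s + k) l := by
  induction k generalizing s with
  | zero => simp
  | succ k ih =>
    rw [add_right_comm, seg_succ, ih, seg_succ, List.cons_append,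
      show s + 1 + (k : ℤ) = s + ((k + 1 : ℕ) : ℤ) by push_cast; ring]

theorem seg_succ' (s : ℤ) (l : ℕ) : seg v s (l + 1) = seg v s l ++ [v (s + l)] := by
  rw [seg_add]
  rfl

theorem seg_append {s t : ℤ} {k : ℕ} (h : t = s + k) (l : ℕ) :
    seg v s k ++ seg v t l = seg v s (k + l) := by
  rw [h, seg_add]

theorem seg_eq_ofFn (s : ℤ) (l : ℕ) : seg v s l = List.ofFn fun i : Fin l => v (s + (i : ℕ)) := by
  induction l generalizing s with
  | zero => simp
  | succ l ih =>
    rw [seg_succ, ih, List.ofFn_succ]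
    simp [add_assoc, add_comm (1 : ℤ)]

theorem seg_congr {v w : ℤ → M} {s : ℤ} {l : ℕ} (h : ∀ k : ℤ, s ≤ k → k < s + l → v k = w k) :
    seg v s l = seg w s l := by
  rw [seg_eq_ofFn, seg_eq_ofFn]
  congr 1
  funext i
  exact h _ (by omega) (by omega)

end Segments

/-! ### Plücker relations and rotation for blocks of consecutive columns -/

section Plucker

variable {K : Type*} [Field K] {n : ℕ}

/-- A normal form for Plücker relations: the two distinguished vectors go to the front. Both cross
`l₁`, so its signs cancel and only `l₂` contributes. -/
theorem listDet_move_two (l₁ l₂ l₃ : List (Fin n → K)) (a b : Fin n → K) :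
    listDet (l₁ ++ (a :: (l₂ ++ (b :: l₃)))) =
      (-1) ^ l₂.length * listDet (a :: b :: (l₁ ++ (l₂ ++ l₃))) := by
  have h1 := listDet_move [] l₁ (a :: (l₂ ++ l₃)) b
  have h2 := listDet_move [b] l₁ (l₂ ++ l₃) a
  have h3 := listDet_move [] [b] (l₁ ++ (l₂ ++ l₃)) a
  have h4 := listDet_move (l₁ ++ [a]) l₂ l₃ b
  have h5 := listDet_move l₁ [a] (l₂ ++ l₃) b
  have e : ((-1 : K) ^ l₁.length) * (-1) ^ l₁.length = 1 := by rw [← mul_pow]; simp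
  simp only [List.nil_append, List.append_assoc, List.cons_append, List.length_singleton,
    pow_one] at *
  rw [h4, h5, h1, h2, h3]
  linear_combination (-1) ^ l₂.length * listDet (a :: b :: (l₁ ++ (l₂ ++ l₃))) * e

/-- The determinants of two segments of a sequence of vectors satisfy the octahedron recurrence. -/
theorem listDet_two_seg (v : ℤ → Fin n → K) (b c : ℤ) {k l : ℕ} (h : k + l + 2 = n) :
    listDet (seg v (b + 1) (k + 1) ++ seg v (c + 1) (l + 1)) *
        listDet (seg v b (k + 1) ++ seg v c (l + 1)) =
      listDet (seg v b (k + 1) ++ seg v (c + 1) (l + 1)) *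
          listDet (seg v (b + 1) (k + 1) ++ seg v c (l + 1)) +
        listDet (seg v (b + 1) k ++ seg v c (l + 2)) *
          listDet (seg v b (k + 2) ++ seg v (c + 1) l) := by
  -- The four distinguished vectors are the two ends of each of the longest blocks; the interiors of
  -- these blocks are common to all six determinants.
  have h0 := listDet_plucker (seg v (b + 1) k ++ seg v (c + 1) l) (by simp; omega)
    (v b) (v c) (v (c + 1 + l)) (v (b + 1 + k))
  have s1 : seg v b (k + 2) = v b :: (seg v (b + 1) k ++ [v (b + 1 + k)]) := by
    rw [seg_succ, seg_succ']
  have s2 : seg v c (l + 2) = v c :: (seg v (c + 1) l ++ [v (c + 1 + l)]) := by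
    rw [seg_succ, seg_succ']
  rw [s1, s2, seg_succ' v (b + 1), seg_succ' v (c + 1), seg_succ v b, seg_succ v c]
  set C := seg v (b + 1) k with hC
  set D := seg v (c + 1) l with hD
  have t1 := listDet_move_two C D [] (v (b + 1 + k)) (v (c + 1 + l))
  have t2 := listDet_move_two [] C D (v b) (v c)
  have t3 := listDet_move_two [] (C ++ D) [] (v b) (v (c + 1 + l))
  have t4 := listDet_move_two C [] D (v (b + 1 + k)) (v c)
  have t5 := listDet_move_two C D [] (v c) (v (c + 1 + l))
  have t6 := listDet_move_two [] C D (v b) (v (b + 1 + k))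
  simp only [List.nil_append, List.append_nil, List.append_assoc, List.cons_append,
    List.length_append, List.length_nil, pow_zero, one_mul, pow_add] at *
  rw [t1, t2, t3, t4, t5, t6]
  linear_combination (-1) ^ C.length * (-1) ^ D.length * h0

/-- The maximal minors of a matrix with an identity block that correspond to contiguous minors of
the other block satisfy the octahedron recurrence. -/
theorem listDet_three_seg (v : ℤ → Fin n → K) (i c k : ℕ) (j : ℤ) (h : c + i + k + 2 = n) :
    listDet (seg v j (c + 1) ++ (seg v n (i + 1) ++ seg v (n + i + c + 2) k)) *
        listDet (seg v (j + 1) (c + 1) ++ (seg v n i ++ seg v (n + i + c + 1) (k + 1))) =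
      listDet (seg v j (c + 1) ++ (seg v n i ++ seg v (n + i + c + 1) (k + 1))) *
          listDet (seg v (j + 1) (c + 1) ++ (seg v n (i + 1) ++ seg v (n + i + c + 2) k)) +
        listDet (seg v j (c + 2) ++ (seg v n i ++ seg v (n + i + c + 2) k)) *
          listDet (seg v (j + 1) c ++ (seg v n (i + 1) ++ seg v (n + i + c + 1) (k + 1))) := by
  set E := seg v (n + i + c + 2) k with hE
  -- For the columns of `(± 1 | M | 1)` this is Dodgson condensation: the distinguished vectors are
  -- the outer two of the `c + 2` columns starting at `j`, and the first and last of the identity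
  -- columns left out by the largest minor.
  have h0 := listDet_plucker (seg v (j + 1) c ++ (seg v n i ++ E)) (by simp [hE]; omega)
    (v j) (v (n + i)) (v (n + i + c + 1)) (v (j + 1 + c))
  have s1 : seg v j (c + 2) = v j :: (seg v (j + 1) c ++ [v (j + 1 + c)]) := by
    rw [seg_succ, seg_succ']
  have s2 : seg v (n + i + c + 1) (k + 1) = v (n + i + c + 1) :: E := by
    rw [seg_succ, hE, add_assoc _ 1 1, one_add_one_eq_two]
  rw [s1, s2, seg_succ' v (j + 1), seg_succ v j, seg_succ' v n]
  set C := seg v (j + 1) c with hC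
  set D := seg v n i with hD
  have t1 := listDet_move_two [] (C ++ D) E (v j) (v (n + i))
  have t2 := listDet_move_two C D E (v (j + 1 + c)) (v (n + i + c + 1))
  have t3 := listDet_move_two [] (C ++ D) E (v j) (v (n + i + c + 1))
  have t4 := listDet_move_two C D E (v (j + 1 + c)) (v (n + i))
  have t5 := listDet_move_two [] C (D ++ E) (v j) (v (j + 1 + c))
  have t6 := listDet_move_two (C ++ D) [] E (v (n + i)) (v (n + i + c + 1))
  have e : ((-1 : K) ^ D.length) * (-1) ^ D.length = 1 := by rw [← mul_pow]; simp
  simp only [List.nil_append, List.append_assoc, List.cons_append,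
    List.length_append, List.length_nil, pow_zero, one_mul, pow_add] at *
  rw [t1, t2, t3, t4, t5, t6]
  linear_combination (-1) ^ C.length * h0 + (-1) ^ C.length * e *
    (listDet (v j :: v (n + i) :: (C ++ (D ++ E))) *
      listDet (v (j + 1 + c) :: v (n + i + c + 1) :: (C ++ (D ++ E))) -
    listDet (v j :: v (n + i + c + 1) :: (C ++ (D ++ E))) *
      listDet (v (j + 1 + c) :: v (n + i) :: (C ++ (D ++ E))))

/-- Moving an initial segment to the end, for a sequence with quasi-period `2 * n`. -/
theorem listDet_rotate (v : ℤ → Fin n → K) (s : ℤ) (k : ℕ) (l : List (Fin n → K))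
    (hl : k + l.length = n)
    (hv : ∀ i, s ≤ i → i < s + k → v i = (-1 : K) ^ (n - 1) • v (i + 2 * n)) :
    listDet (seg v s k ++ l) = listDet (l ++ seg v (s + 2 * n) k) := by
  induction k generalizing s l with
  | zero => simp
  | succ k ih =>
    -- The first vector passes the other `n - 1` vectors, and the resulting sign cancels the
    -- quasi-period sign.
    rw [seg_succ, hv s le_rfl (by push_cast; omega), List.cons_append]
    have h1 := listDet_smul [] (seg v (s + 1) k ++ l) ((-1 : K) ^ (n - 1)) (v (s + 2 * n))
    have h2 := listDet_move [] (seg v (s + 1) k ++ l) [] (v (s + 2 * n))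
    have h3 := ih (s + 1) (l ++ [v (s + 2 * n)]) (by simp; omega)
      (fun i h h' => hv i (by omega) (by push_cast; omega))
    have e2 : k + l.length = n - 1 := by omega
    simp only [List.nil_append, List.append_nil, List.append_assoc, List.cons_append,
      List.length_append, length_seg, e2] at h1 h2 h3
    rw [h1, seg_succ, show s + 2 * (n : ℤ) + 1 = s + 1 + 2 * n by ring, ← h3, h2]

end Plucker

/-! ### Determinantal solutions of both recurrences over a field -/

section Solutions

/-- The recurrence of the half-octahedron, in the coordinates `i = (n + x + t - y) / 2` and
`j = (n + x - t - y) / 2`. -/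
structure IsHalfOctSolution {K : Type*} [Field K] (n : ℕ) (G : ℕ → ℕ → ℕ → K) : Prop where
  inner : ∀ i j y, i + y + 2 ≤ n → j + y + 2 ≤ n →
    G (i + 1) j (y + 1) * G i (j + 1) (y + 1) =
      G i j (y + 1) * G (i + 1) (j + 1) (y + 1) + G i j (y + 2) * G (i + 1) (j + 1) y
  wall : ∀ i j, i + 1 ≤ n → j + 1 ≤ n →
    G (i + 1) j 0 * G i (j + 1) 0 = G i j 0 * G (i + 1) (j + 1) 0

/-- The recurrence of the domain `A₂`, where the time is replaced by the coordinate
`a = (n + t - x - y) / 2`. -/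
structure IsPrismSolution {K : Type*} [Field K] (n : ℕ) (G : ℕ → ℕ → ℕ → K) : Prop where
  inner : ∀ x y a, x + a + 2 ≤ n → y + 2 ≤ n →
    G (x + 1) (y + 1) (a + 1) * G (x + 1) (y + 1) a =
      G (x + 2) (y + 1) a * G x (y + 1) (a + 1) + G (x + 1) (y + 2) a * G (x + 1) y (a + 1)
  wall_bot : ∀ x a, x + a + 2 ≤ n →
    G (x + 1) 0 (a + 1) * G (x + 1) 0 a = G (x + 2) 0 a * G x 0 (a + 1)
  wall_top : ∀ x a, x + a + 2 ≤ n →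
    G (x + 1) n (a + 1) * G (x + 1) n a = G (x + 2) n a * G x n (a + 1)
  wall_x : ∀ y a, a + 1 ≤ n → y + 2 ≤ n →
    G 0 (y + 1) (a + 1) * G 0 (y + 1) a = G 0 (y + 2) a * G 0 y (a + 1)
  corner_bot : ∀ a, a + 1 ≤ n → G 0 0 (a + 1) * G 0 0 a = G 1 0 a * G 0 1 a
  corner_top : ∀ a, a + 1 ≤ n → G 0 n (a + 1) * G 0 n a = G 1 n a * G 0 (n - 1) (a + 1)

/-- The values on the lower boundaries agree under the identification `s`. -/
structure LowerMatch {K : Type*} (n : ℕ) (G₁ G₂ : ℕ → ℕ → ℕ → K) : Prop where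
  left : ∀ x y, x + y ≤ n → G₂ x y 0 = G₁ 0 x y
  right : ∀ x y i, x ≤ n → y ≤ n → x + y = n + i → G₂ x y 0 = G₁ i x (n - x)

/-- The values on the upper boundaries agree under the identification `s'`. -/
structure UpperMatch {K : Type*} (n : ℕ) (G₁ G₂ : ℕ → ℕ → ℕ → K) : Prop where
  right : ∀ x y, x ≤ y → y ≤ n → G₂ x y (n - x) = G₁ y (y - x) (n - y)
  left : ∀ x y, y ≤ x → x ≤ n → G₂ x y (n - x) = G₁ y 0 (n - x)

variable {K : Type*} [Field K] {n : ℕ}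

/-- The columns of the `n × 3n` matrix `(± 1 | M | 1)`, where `M` is the matrix, up to signs, of
the values of `G` at height one. -/
noncomputable def colVec (n : ℕ) (G : ℕ → ℕ → ℕ → K) (k : ℤ) : Fin n → K :=
  if k < 0 then (-1 : K) ^ (n - 1) • fun i : Fin n => if k + n = (i : ℕ) then 1 else 0
  else if k < n then fun i => (-1) ^ (i : ℕ) * G i k.toNat 1
  else fun i => if k - n = (i : ℕ) then 1 else 0

theorem colVec_of_neg (G : ℕ → ℕ → ℕ → K) {k : ℤ} (h0 : -(n : ℤ) ≤ k) (h : k < 0) :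
    colVec n G k = (-1 : K) ^ (n - 1) • colVec n G (k + 2 * n) := by
  rw [colVec, colVec, if_pos h, if_neg (by omega), if_neg (by omega),
    show k + 2 * (n : ℤ) - n = k + n by ring]

theorem colVec_natCast (G : ℕ → ℕ → ℕ → K) (j : ℕ) (h : j < n) (i : Fin n) :
    colVec n G j i = (-1) ^ (i : ℕ) * G i j 1 := by
  rw [colVec, if_neg (by omega), if_pos (by omega), Int.toNat_natCast]

theorem colVec_add (G : ℕ → ℕ → ℕ → K) (i : ℕ) (j : Fin n) :
    colVec n G (n + i) j = if i = (j : ℕ) then 1 else 0 := by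
  rw [colVec, if_neg (by omega), if_neg (by omega), add_sub_cancel_left]
  norm_cast

theorem listDet_identity (G : ℕ → ℕ → ℕ → K) : listDet (seg (colVec n G) n n) = 1 := by
  rw [seg_eq_ofFn, listDet_ofFn, ← Matrix.det_one (n := Fin n) (R := K)]
  congr 1
  ext i j
  rw [Matrix.of_apply, colVec_add, Matrix.one_apply]
  simp only [Fin.ext_iff]

/-- By Cramer's rule for the identity matrix, replacing its `i`-th row by `w` gives determinant `w
i`. This is the `1 × 1` case of reading minors of `M` as maximal minors. -/
theorem listDet_identity_update (G : ℕ → ℕ → ℕ → K) (w : Fin n → K) (i : Fin n) (k : ℕ)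
    (h : i + 1 + k = n) :
    listDet (seg (colVec n G) n i ++ w :: seg (colVec n G) (n + i + 1) k) = w i := by
  have e1 : seg (colVec n G) n i = seg (Function.update (colVec n G) (n + i) w) n i :=
    seg_congr fun k _ hk => (Function.update_of_ne (by omega) _ _).symm
  have e2 : seg (colVec n G) (n + i + 1) k =
      seg (Function.update (colVec n G) (n + i) w) (n + i + 1) k :=
    seg_congr fun k hk _ => (Function.update_of_ne (by omega) _ _).symm
  have e3 : w = Function.update (colVec n G) (n + i) w (n + i) := by
    rw [Function.update_self]
  have e4 : seg (colVec n G) n i ++ w :: seg (colVec n G) (n + i + 1) k =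
      seg (Function.update (colVec n G) (n + i) w) n n := by
    rw [e1, e2]
    nth_rw 2 [e3]
    rw [← seg_succ, seg_append _ rfl]
    congr 1
    omega
  rw [e4, seg_eq_ofFn, listDet_ofFn]
  have e5 : Matrix.of (fun k : Fin n => Function.update (colVec n G) (n + i) w (n + (k : ℕ))) =
      (1 : Matrix (Fin n) (Fin n) K).updateRow i w := by
    ext a b
    rw [Matrix.of_apply]
    by_cases hai : a = i
    · subst hai
      rw [Function.update_self, Matrix.updateRow_self]
    · rw [Function.update_of_ne, colVec_add, Matrix.updateRow_ne hai, Matrix.one_apply]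
      · simp only [Fin.ext_iff]
      · intro h'
        apply hai
        apply Fin.ext
        omega
  have e6 := Matrix.cramer_transpose_apply (1 : Matrix (Fin n) (Fin n) K) w i
  rw [Matrix.transpose_one, Matrix.cramer_one] at e6
  rw [e5, ← e6]
  rfl

/-- A normalized solution in the half-octahedron consists of the contiguous minors of a matrix. -/
theorem IsHalfOctSolution.eq_listDet {G : ℕ → ℕ → ℕ → K} (hG : IsHalfOctSolution n G)
    (hne : ∀ i j y, G i j y ≠ 0) (h0 : ∀ i j, i ≤ n → j ≤ n → G i j 0 = 1) (y : ℕ) :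
    ∀ i j k, i + y + k = n → j + y ≤ n →
      G i j y = listDet (seg (colVec n G) j y ++ (seg (colVec n G) n i ++
        seg (colVec n G) (n + i + y) k)) := by
  induction y using Nat.strong_induction_on with
  | _ y ih =>
  intro i j k hk hj
  match y, ih with
  | 0, _ =>
    rw [h0 i j (by omega) (by omega), seg_zero, List.nil_append, seg_append _ (by simp),
      show i + k = n by omega, listDet_identity]
  | 1, _ =>
    -- Column `j` of `M` stands in front of `i` identity columns; the sign of moving it into place
    -- cancels the factor `(-1) ^ i` in `colVec`.
    have h1 := listDet_move [] (seg (colVec n G) n i)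
      (seg (colVec n G) (n + i + 1) k) (colVec n G j)
    have h2 := listDet_identity_update G (colVec n G j) ⟨i, by omega⟩ k hk
    have e : ((-1 : K) ^ i) * (-1) ^ i = 1 := by rw [← mul_pow]; simp
    simp only [List.nil_append, length_seg] at h1 h2
    rw [h1, colVec_natCast _ _ (by omega)] at h2
    simp only [seg_succ, seg_zero, List.cons_append, List.nil_append, Nat.cast_one]
    linear_combination (-1) ^ i * (-h2) - (G i j 1 -
      listDet (colVec n G j :: (seg (colVec n G) n i ++ seg (colVec n G) (n + i + 1) k))) * e
  | y + 2, ih =>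
    have h1 := hG.inner i j y (by omega) (by omega)
    have h2 := listDet_three_seg (colVec n G) i y k j (by omega)
    have a1 := ih (y + 1) (by omega) (i + 1) j k (by omega) (by omega)
    have a2 := ih (y + 1) (by omega) i (j + 1) (k + 1) (by omega) (by omega)
    have a3 := ih (y + 1) (by omega) i j (k + 1) (by omega) (by omega)
    have a4 := ih (y + 1) (by omega) (i + 1) (j + 1) k (by omega) (by omega)
    have a5 := ih y (by omega) (i + 1) (j + 1) (k + 1) (by omega) (by omega)
    have c1 : (n : ℤ) + ((i + 1 : ℕ) : ℤ) + ((y + 1 : ℕ) : ℤ) = n + i + y + 2 := by push_cast; ring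
    have c2 : (n : ℤ) + (i : ℤ) + ((y + 1 : ℕ) : ℤ) = n + i + y + 1 := by push_cast; ring
    have c3 : (n : ℤ) + ((i + 1 : ℕ) : ℤ) + (y : ℤ) = n + i + y + 1 := by push_cast; ring
    have c4 : (n : ℤ) + (i : ℤ) + ((y + 2 : ℕ) : ℤ) = n + i + y + 2 := by push_cast; ring
    rw [c1] at a1 a4
    rw [c2] at a2 a3
    rw [c3] at a5
    rw [Nat.cast_succ] at a2 a4 a5
    rw [← a1, ← a2, ← a3, ← a4, ← a5, h1] at h2
    rw [c4]
    -- The recurrence and Dodgson condensation agree in all terms but the minor of size `y + 2`,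
    -- which is determined because its cofactor, of size `y`, is nonzero.
    exact mul_right_cancel₀ (hne (i + 1) (j + 1) y) (add_left_cancel h2)

/-- The determinants satisfy every rule of the recurrence, and nonvanishing lets each rule determine
the value at `a + 1`. Within the layer `a + 1` the rules also refer to smaller `x` or `y`, hence the
nested inductions on `a`, `x`, `y`. In the interior the rule is `listDet_two_seg`; on the walls and
corners the minors depend on fewer parameters and the rules reduce to equalities. -/
theorem prism_determinants (v : ℤ → Fin n → K) {G : ℕ → ℕ → ℕ → K} (hn : 0 < n)
    (hG : IsPrismSolution n G) (hne : ∀ x y a, G x y a ≠ 0)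
    (h0 : ∀ x y z, x ≤ n → y + z = n → G x y 0 = listDet (seg v (-z) z ++ seg v x y)) (a : ℕ) :
    ∀ x y z, x + a ≤ n → y + z = n →
      G x y a = listDet (seg v (a - z) z ++ seg v (a + x) y) := by
  -- On the wall `x = 0` the two blocks are adjacent and merge into one block of length `n` that
  -- depends only on `a + y`.
  have side : ∀ (a : ℤ) (y z : ℕ), y + z = n →
      seg v (a - z) z ++ seg v (a + (0 : ℕ)) y = seg v (a + y - n) n := by
    intro a y z h
    rw [seg_append _ (by simp)]
    congr 1 <;> omega
  induction a with
  | zero =>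
    intro x y z hx hy
    rw [h0 x y z (by omega) hy]
    simp
  | succ a ih =>
    intro x
    induction x with
    | zero =>
      intro y
      induction y with
      | zero =>
        intro z hx hy
        -- At `y = 0` the second block is empty and the minor does not depend on `x`, so `G 1 0 a =
        -- G 0 0 a` cancels.
        have h1 := hG.corner_bot a (by omega)
        have a1 := ih 0 0 n (by omega) (by omega)
        have a2 := ih 1 0 n (by omega) (by omega)
        have a3 := ih 0 1 (n - 1) (by omega) (by omega)
        rw [side a 0 n (by omega)] at a1
        rw [side a 1 (n - 1) (by omega)] at a3
        rw [seg_zero, List.append_nil] at a2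
        rw [Nat.cast_zero, add_zero] at a1
        rw [side ((a + 1 : ℕ) : ℤ) 0 z (by omega)]
        rw [← a1] at a2
        rw [a2, mul_comm] at h1
        rw [mul_left_cancel₀ (hne _ _ _) h1, a3]
        congr 3
      | succ y ihy =>
        intro z hx hy
        have a1 := ih 0 (y + 1) z (by omega) (by omega)
        have a4 := ihy (z + 1) (by omega) (by omega)
        rw [side _ _ _ (by omega)] at a1 a4 ⊢
        rw [show ((a + 1 : ℕ) : ℤ) + (y : ℕ) - n = a + ((y + 1 : ℕ) : ℤ) - n by push_cast; ring,
          ← a1] at a4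
        rcases Nat.lt_or_ge (y + 1) n with h | h
        · have h1 := hG.wall_x y a (by omega) (by omega)
          have a3 := ih 0 (y + 2) (z - 1) (by omega) (by omega)
          rw [side _ _ _ (by omega)] at a3
          rw [a4] at h1
          rw [mul_right_cancel₀ (hne _ _ _) h1, a3]
          congr 2
          omega
        · obtain rfl : n = y + 1 := by omega
          have h1 := hG.corner_top a (by omega)
          have a3 := ih 1 (y + 1) z (by omega) (by omega)
          obtain rfl : z = 0 := by omega
          rw [Nat.add_sub_cancel, a4] at h1
          rw [mul_right_cancel₀ (hne _ _ _) h1, a3, seg_zero, List.nil_append]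
          congr 2
          push_cast
          ring
    | succ x ihx =>
      intro y
      induction y with
      | zero =>
        intro z hx hy
        have h1 := hG.wall_bot x a (by omega)
        have a1 := ih (x + 1) 0 z (by omega) (by omega)
        have a2 := ih (x + 2) 0 z (by omega) (by omega)
        have a3 := ihx 0 z (by omega) (by omega)
        rw [seg_zero] at a1 a2 a3 ⊢
        rw [a1, a2, mul_comm, ← a2] at h1
        rw [mul_left_cancel₀ (hne _ _ _) h1, a3]
      | succ y ihy =>
        intro z hx hy
        rcases Nat.lt_or_ge (y + 1) n with h | h
        · obtain ⟨z, rfl⟩ : ∃ w, z = w + 1 := ⟨z - 1, by omega⟩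
          have h1 := hG.inner x y a (by omega) (by omega)
          have a1 := ih (x + 1) (y + 1) (z + 1) (by omega) (by omega)
          have a2 := ih (x + 2) (y + 1) (z + 1) (by omega) (by omega)
          have a3 := ih (x + 1) (y + 2) z (by omega) (by omega)
          have a4 := ihx (y + 1) (z + 1) (by omega) (by omega)
          have a5 := ihy (z + 2) (by omega) (by omega)
          have h2 := listDet_two_seg v ((a : ℤ) - z - 1) (a + x + 1) (k := z) (l := y) (by omega)
          have c1 : (a : ℤ) - ((z + 1 : ℕ) : ℤ) = a - z - 1 := by push_cast; ring
          have c2 : (a : ℤ) + ((x + 1 : ℕ) : ℤ) = a + x + 1 := by push_cast; ring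
          have c3 : (a : ℤ) + ((x + 2 : ℕ) : ℤ) = a + x + 1 + 1 := by push_cast; ring
          have c4 : ((a + 1 : ℕ) : ℤ) - ((z + 1 : ℕ) : ℤ) = a - z := by push_cast; ring
          have c5 : ((a + 1 : ℕ) : ℤ) + (x : ℤ) = a + x + 1 := by push_cast; ring
          have c6 : ((a + 1 : ℕ) : ℤ) - ((z + 2 : ℕ) : ℤ) = a - z - 1 := by push_cast; ring
          have c7 : ((a + 1 : ℕ) : ℤ) + ((x + 1 : ℕ) : ℤ) = a + x + 1 + 1 := by push_cast; ring
          rw [c1, c2] at a1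
          rw [c1, c3] at a2
          rw [c2] at a3
          rw [c4, c5] at a4
          rw [c6, c7] at a5
          rw [c4, c7]
          rw [sub_add_cancel, ← a1, ← a2, ← a3, ← a4, ← a5, ← h1] at h2
          exact (mul_right_cancel₀ (hne _ _ _) h2).symm
        · obtain rfl : n = y + 1 := by omega
          obtain rfl : z = 0 := by omega
          -- At `y = n` the first block is empty and the minor depends only on `a + x`.
          have h1 := hG.wall_top x a (by omega)
          have a1 := ih (x + 1) (y + 1) 0 (by omega) (by omega)
          have a2 := ih (x + 2) (y + 1) 0 (by omega) (by omega)
          have a3 := ihx (y + 1) 0 (by omega) (by omega)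
          rw [seg_zero, List.nil_append] at a1 a2 a3 ⊢
          rw [show ((a + 1 : ℕ) : ℤ) + (x : ℤ) = a + ((x + 1 : ℕ) : ℤ) by push_cast; ring,
            ← a1] at a3
          rw [a3] at h1
          rw [mul_right_cancel₀ (hne _ _ _) h1, a2]
          congr 2
          push_cast
          ring

/-- When the wall values are one, both solutions are minors of the same columns, and on both
boundaries the two minors differ only by a rotation of columns with negative index. No scaling
factor is needed in this case. -/
theorem upperMatch_of_normalized {G₁ G₂ : ℕ → ℕ → ℕ → K} (hn : 0 < n)
    (h₁ : IsHalfOctSolution n G₁) (h₂ : IsPrismSolution n G₂) (hne₁ : ∀ i j y, G₁ i j y ≠ 0)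
    (hne₂ : ∀ x y a, G₂ x y a ≠ 0) (h0 : ∀ i j, i ≤ n → j ≤ n → G₁ i j 0 = 1)
    (hlow : LowerMatch n G₁ G₂) : UpperMatch n G₁ G₂ := by
  set v := colVec n G₁ with hv
  have d₁ := h₁.eq_listDet hne₁ h0
  have rot : ∀ (s : ℤ) (k : ℕ) (l : List (Fin n → K)), -(n : ℤ) ≤ s → s + k ≤ 0 →
      k + l.length = n → listDet (seg v s k ++ l) = listDet (l ++ seg v (s + 2 * n) k) :=
    fun s k l hs hk hl => listDet_rotate v s k l hl
      fun i h h' => colVec_of_neg G₁ (by omega) (by omega)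
  -- The initial condition: the block `[-z, 0)` rotates to `[2n - z, 2n)`, the final part of the
  -- right identity block. For `x + y ≤ n` the other block lies inside `M`; otherwise it runs past
  -- `M` into the first `i` identity columns.
  have d₂ := prism_determinants v hn h₂ hne₂ (fun x y z hx hz => by
    rw [rot _ _ _ (by omega) (by omega) (by simp; omega)]
    rcases Nat.le_total (x + y) n with h | h
    · rw [hlow.left x y h, d₁ y 0 x z (by omega) h, seg_zero, List.nil_append]
      congr 3
      push_cast
      omega
    · obtain ⟨i, hi⟩ := Nat.exists_eq_add_of_le h
      rw [hlow.right x y i hx (by omega) hi, d₁ (n - x) i x z (by omega) (by omega),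
        ← List.append_assoc, seg_append _ (by omega)]
      congr 3
      · omega
      · omega)
  refine ⟨fun x y hxy hy => ?_, fun x y hxy hx => ?_⟩
  · rw [d₂ (n - x) x y (n - y) (by omega) (by omega), d₁ (n - y) y (y - x) 0 (by omega) (by omega),
      seg_zero, List.append_nil]
    congr 3 <;> omega
  · rw [d₂ (n - x) x y (n - y) (by omega) (by omega), d₁ (n - x) y 0 (x - y) (by omega) (by omega)]
    obtain ⟨k, rfl⟩ := Nat.exists_eq_add_of_le hxy
    -- Here the first block starts at the negative index `-k`, with `k = x - y`; only the columns
    -- before `0` have to be rotated.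
    have e : seg v (((n - (y + k) : ℕ) : ℤ) - ((n - y : ℕ) : ℤ)) (n - y) =
        seg v (-(k : ℤ)) k ++ seg v (0 : ℕ) (n - (y + k)) := by
      rw [seg_append _ (by simp)]
      congr 1 <;> omega
    rw [e, List.append_assoc, rot _ _ _ (by omega) (by omega) (by simp; omega), List.append_assoc]
    congr 3
    · congr 1
      omega
    · congr 1 <;> omega

/-- All products in one rule contain the same pair of values of `i` and the same pair of values of
`j + y`, so the rule is multiplied by a common factor. The shift by `n` matches `i + n` with `x + y`
where `right` of `LowerMatch` identifies points. -/
theorem IsHalfOctSolution.gauge {G : ℕ → ℕ → ℕ → K} (hG : IsHalfOctSolution n G) (c : K)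
    (δ : ℕ → K) : IsHalfOctSolution n fun i j y => G i j y * (c * (δ (i + n) * δ (j + y))) := by
  refine ⟨fun i j y hi hj => ?_, fun i j hi hj => ?_⟩
  · have h := hG.inner i j y hi hj
    rw [show j + 1 + (y + 1) = j + y + 2 by ring, show j + (y + 1) = j + y + 1 by ring,
      show j + (y + 2) = j + y + 2 by ring, show j + 1 + y = j + y + 1 by ring]
    linear_combination (c ^ 2 * δ (i + 1 + n) * δ (i + n) * δ (j + y + 1) * δ (j + y + 2)) * h
  · have h := hG.wall i j hi hj
    simp only [add_zero]
    linear_combination (c ^ 2 * δ (i + 1 + n) * δ (i + n) * δ (j + 1) * δ j) * h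

/-- As for the half-octahedron, with the invariants `x + y + a` and `a`. On the identified
boundaries the factors of the two gauges agree up to a constant. -/
theorem IsPrismSolution.gauge {G : ℕ → ℕ → ℕ → K} (hG : IsPrismSolution n G) (hn : 0 < n) (c : K)
    (δ : ℕ → K) : IsPrismSolution n fun x y a => G x y a * (c * (δ (x + y + a) * δ a)) := by
  refine ⟨fun x y a hx hy => ?_, fun x a hx => ?_, fun x a hx => ?_, fun y a ha hy => ?_,
    fun a ha => ?_, fun a ha => ?_⟩
  · have h := hG.inner x y a hx hy
    rw [show x + 1 + (y + 1) + (a + 1) = x + y + a + 3 by ring,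
      show x + 1 + (y + 1) + a = x + y + a + 2 by ring,
      show x + 2 + (y + 1) + a = x + y + a + 3 by ring,
      show x + (y + 1) + (a + 1) = x + y + a + 2 by ring,
      show x + 1 + (y + 2) + a = x + y + a + 3 by ring,
      show x + 1 + y + (a + 1) = x + y + a + 2 by ring]
    linear_combination (c ^ 2 * δ (x + y + a + 3) * δ (x + y + a + 2) * δ a * δ (a + 1)) * h
  · have h := hG.wall_bot x a hx
    rw [show x + 1 + 0 + (a + 1) = x + a + 2 by ring, show x + 1 + 0 + a = x + a + 1 by ring,
      show x + 2 + 0 + a = x + a + 2 by ring, show x + 0 + (a + 1) = x + a + 1 by ring]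
    linear_combination (c ^ 2 * δ (x + a + 2) * δ (x + a + 1) * δ a * δ (a + 1)) * h
  · have h := hG.wall_top x a hx
    rw [show x + 1 + n + (a + 1) = x + n + a + 2 by ring,
      show x + 1 + n + a = x + n + a + 1 by ring, show x + 2 + n + a = x + n + a + 2 by ring,
      show x + n + (a + 1) = x + n + a + 1 by ring]
    linear_combination (c ^ 2 * δ (x + n + a + 2) * δ (x + n + a + 1) * δ a * δ (a + 1)) * h
  · have h := hG.wall_x y a ha hy
    rw [show 0 + (y + 1) + (a + 1) = y + a + 2 by ring, show 0 + (y + 1) + a = y + a + 1 by ring,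
      show 0 + (y + 2) + a = y + a + 2 by ring, show 0 + y + (a + 1) = y + a + 1 by ring]
    linear_combination (c ^ 2 * δ (y + a + 2) * δ (y + a + 1) * δ a * δ (a + 1)) * h
  · have h := hG.corner_bot a ha
    rw [show 0 + 0 + (a + 1) = a + 1 by ring, show 0 + 0 + a = a by ring,
      show 1 + 0 + a = a + 1 by ring]
    linear_combination (c ^ 2 * δ (a + 1) ^ 2 * δ a ^ 2) * h
  · have h := hG.corner_top a ha
    rw [show 0 + n + (a + 1) = n + a + 1 by ring, show 0 + n + a = n + a by ring,
      show 1 + n + a = n + a + 1 by ring, show 0 + (n - 1) + (a + 1) = n + a by omega]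
    linear_combination (c ^ 2 * δ (n + a + 1) * δ (n + a) * δ a * δ (a + 1)) * h

/-- The wall rule says that adjacent `2 × 2` minors of the array `G i j 0` vanish; with nonzero
entries this array has rank one. -/
theorem IsHalfOctSolution.wall_eq {G : ℕ → ℕ → ℕ → K} (hG : IsHalfOctSolution n G)
    (hne : ∀ i j y, G i j y ≠ 0) (i j : ℕ) (hi : i ≤ n) (hj : j ≤ n) :
    G i j 0 * G 0 n 0 = G i n 0 * G 0 j 0 := by
  have key : ∀ k i j, i + 1 ≤ n → j + k = n →
      G (i + 1) j 0 * G i n 0 = G i j 0 * G (i + 1) n 0 := by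
    intro k
    induction k with
    | zero =>
      rintro i j - rfl
      rw [mul_comm, add_zero]
    | succ k ih =>
      intro i j hi hj
      have h1 := ih i (j + 1) hi (by omega)
      have h2 := hG.wall i j hi (by omega)
      refine mul_right_cancel₀ (hne i (j + 1) 0) ?_
      linear_combination G i n 0 * h2 + G i j 0 * h1
  induction i with
  | zero => rw [mul_comm]
  | succ i ih =>
    have h1 := ih (by omega)
    have h2 := key (n - j) i j hi (by omega)
    refine mul_right_cancel₀ (hne i n 0) ?_
    linear_combination G 0 n 0 * h2 + G (i + 1) n 0 * h1

/-- Solutions in the half-octahedron and in `A₂` with the same values on the lower boundaries have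
proportional values on the upper boundaries. -/
theorem upperMatch_of_lowerMatch {G₁ G₂ : ℕ → ℕ → ℕ → K} (hn : 0 < n)
    (h₁ : IsHalfOctSolution n G₁) (h₂ : IsPrismSolution n G₂) (hne₁ : ∀ i j y, G₁ i j y ≠ 0)
    (hne₂ : ∀ x y a, G₂ x y a ≠ 0) (hlow : LowerMatch n G₁ G₂) :
    UpperMatch n (fun i j y => G₁ i j y * G₁ 0 n 0) (fun x y a => G₂ x y a * G₁ 0 0 0) := by
  -- `ε` lists the initial values along the wall `y = 0` of the lower boundary, from `(-n, 0, 0)`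
  -- through `(0, 0, -n)` at index `n` to `(n, 0, 0)`.
  obtain ⟨ε, hε, hε₁, hε₂⟩ : ∃ ε : ℕ → K, (∀ k, ε k ≠ 0) ∧ (∀ k ≤ n, ε k = G₁ 0 k 0) ∧
      ∀ i, ε (i + n) = G₁ i n 0 := by
    refine ⟨fun k => if k ≤ n then G₁ 0 k 0 else G₁ (k - n) n 0, fun k => ?_, fun k hk => if_pos hk,
      fun i => ?_⟩
    · dsimp only
      split_ifs
      exacts [hne₁ _ _ _, hne₁ _ _ _]
    · dsimp only
      rcases Nat.eq_zero_or_pos i with rfl | hi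
      · rw [if_pos (by omega), zero_add]
      · rw [if_neg (by omega), Nat.add_sub_cancel]
  have e0 := hε₁ 0 (by omega)
  have en := hε₁ n le_rfl
  have hδ : ∀ k, (ε k)⁻¹ ≠ 0 := fun k => inv_ne_zero (hε k)
  -- The constant `ε n` makes the wall values one, by the rank one identity. The constant `ε 0` is
  -- forced by the match on the lower boundary: the factors are `δ n * δ (x + y)` in `A₁` and `δ (x
  -- + y) * δ 0` in `A₂` on its left part.
  have key := upperMatch_of_normalized hn (h₁.gauge (ε n) fun k => (ε k)⁻¹)
    (h₂.gauge hn (ε 0) fun k => (ε k)⁻¹)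
    (fun i j y => mul_ne_zero (hne₁ _ _ _) (mul_ne_zero (hε _) (mul_ne_zero (hδ _) (hδ _))))
    (fun i j y => mul_ne_zero (hne₂ _ _ _) (mul_ne_zero (hε _) (mul_ne_zero (hδ _) (hδ _))))
    (fun i j hi hj => by
      have h := h₁.wall_eq hne₁ i j hi hj
      have z1 := hε (i + n)
      have z2 := hε j
      rw [add_zero]
      field_simp
      rw [en, h, hε₂, hε₁ j hj])
    ⟨fun x y h => by
      have z0 := hε 0
      have zn := hε n
      rw [hlow.left x y h, add_zero, zero_add]
      field_simp, fun x y i hx hy h => by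
      have z0 := hε 0
      have zn := hε n
      rw [hlow.right x y i hx hy h, add_zero, h, show x + (n - x) = n by omega, add_comm i n]
      field_simp⟩
  -- On the upper boundary both gauges contribute `δ (y + n) * δ (n - x)`, so only the constants `ε
  -- 0` and `ε n` survive.
  refine ⟨fun x y hxy hy => ?_, fun x y hxy hx => ?_⟩
  · have h := key.right x y hxy hy
    rw [show x + y + (n - x) = y + n by omega, show y - x + (n - y) = n - x by omega] at h
    have z := mul_ne_zero (hδ (y + n)) (hδ (n - x))
    rw [← mul_assoc (G₂ x y (n - x)), ← mul_assoc (G₁ y (y - x) (n - y))] at h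
    have h := mul_right_cancel₀ z h
    rwa [e0, en] at h
  · have h := key.left x y hxy hx
    rw [show x + y + (n - x) = y + n by omega, zero_add] at h
    have z := mul_ne_zero (hδ (y + n)) (hδ (n - x))
    rw [← mul_assoc (G₂ x y (n - x)), ← mul_assoc (G₁ y 0 (n - x))] at h
    have h := mul_right_cancel₀ z h
    rwa [e0, en] at h

end Solutions

/-! ### Subtraction-free rational functions and their values -/

section Universal

variable {F : Type*} [PosSemifield F]

/-- A semifield with a zero adjoined is a commutative semiring. -/
instance withZeroCommSemiring : CommSemiring (WithZero F) where
  __ := (inferInstance : AddCommMonoid (WithZero F))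
  __ := (inferInstance : CommMonoidWithZero (WithZero F))
  __ := (inferInstance : Distrib (WithZero F))

variable {σ : Type*} (g : σ → F)

/-- The field of rational functions over `ℚ`. -/
abbrev RationalFunctions (σ : Type*) : Type _ := FractionRing (MvPolynomial σ ℤ)

/-- A polynomial with coefficients in `ℕ`, as a rational function. -/
noncomputable def toRat (σ : Type*) : MvPolynomial σ ℕ →+* RationalFunctions σ :=
  (algebraMap (MvPolynomial σ ℤ) (RationalFunctions σ)).comp (MvPolynomial.map (Nat.castRingHom ℤ))

theorem toRat_injective (σ : Type*) : Function.Injective (toRat σ) :=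
  (IsFractionRing.injective (MvPolynomial σ ℤ) (RationalFunctions σ)).comp
    (MvPolynomial.map_injective _ Nat.cast_injective)

/-- The value of a polynomial with coefficients in `ℕ` at a point of `F ^ σ`. -/
noncomputable def evalAt : MvPolynomial σ ℕ →+* WithZero F :=
  MvPolynomial.eval₂Hom (Nat.castRingHom _) fun i => (g i : WithZero F)

/-- `P / Q` is a subtraction-free expression of the rational function `u` that takes the value `a`
at `g`. -/
def IsExpression (u : RationalFunctions σ) (a : F) (P Q : MvPolynomial σ ℕ) : Prop :=
  evalAt g Q ≠ 0 ∧ u * toRat σ Q = toRat σ P ∧ (a : WithZero F) * evalAt g Q = evalAt g P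

variable {g}

theorem IsExpression.num_ne_zero {u : RationalFunctions σ} {a : F} {P Q : MvPolynomial σ ℕ}
    (h : IsExpression g u a P Q) : evalAt g P ≠ 0 :=
  h.2.2 ▸ mul_ne_zero WithZero.coe_ne_zero h.1

theorem toRat_ne_zero {P : MvPolynomial σ ℕ} (h : evalAt g P ≠ 0) : toRat σ P ≠ 0 := by
  intro h0
  rw [← map_zero (toRat σ)] at h0
  exact h (by rw [toRat_injective σ h0, map_zero])

theorem IsExpression.ne_zero {u : RationalFunctions σ} {a : F} {P Q : MvPolynomial σ ℕ}
    (h : IsExpression g u a P Q) : u ≠ 0 := by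
  rintro rfl
  exact toRat_ne_zero h.num_ne_zero (by rw [← h.2.1, zero_mul])

/-- Two expressions of one rational function satisfy `P * Q' = P' * Q` already over `ℕ`, and this
can be evaluated in `WithZero F`. So the value does not depend on the expression, although `F` need
not be cancellative for addition. -/
theorem IsExpression.unique {u : RationalFunctions σ} {a b : F} {P Q P' Q' : MvPolynomial σ ℕ}
    (h : IsExpression g u a P Q) (h' : IsExpression g u b P' Q') : a = b := by
  have e : toRat σ (P * Q') = toRat σ (P' * Q) := by
    rw [map_mul, map_mul, ← h.2.1, ← h'.2.1]
    ring
  have e' := congrArg (evalAt g) (toRat_injective σ e)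
  rw [map_mul, map_mul, ← h.2.2, ← h'.2.2, mul_assoc, mul_assoc, mul_comm (evalAt g Q')] at e'
  exact WithZero.coe_injective (mul_right_cancel₀ (mul_ne_zero h.1 h'.1) e')

theorem IsExpression.mul {u w : RationalFunctions σ} {a b : F} {P Q P' Q' : MvPolynomial σ ℕ}
    (h : IsExpression g u a P Q) (h' : IsExpression g w b P' Q') :
    IsExpression g (u * w) (a * b) (P * P') (Q * Q') := by
  refine ⟨?_, ?_, ?_⟩
  · rw [map_mul]
    exact mul_ne_zero h.1 h'.1
  · rw [map_mul, map_mul, mul_mul_mul_comm, h.2.1, h'.2.1]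
  · rw [map_mul, map_mul, WithZero.coe_mul, mul_mul_mul_comm, h.2.2, h'.2.2]

theorem IsExpression.add {u w : RationalFunctions σ} {a b : F} {P Q P' Q' : MvPolynomial σ ℕ}
    (h : IsExpression g u a P Q) (h' : IsExpression g w b P' Q') :
    IsExpression g (u + w) (a + b) (P * Q' + Q * P') (Q * Q') := by
  refine ⟨?_, ?_, ?_⟩
  · rw [map_mul]
    exact mul_ne_zero h.1 h'.1
  · simp only [map_mul, map_add, ← h.2.1, ← h'.2.1]
    ring
  · simp only [map_mul, map_add, ← h.2.2, ← h'.2.2, WithZero.coe_add]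
    ring

theorem IsExpression.inv {u : RationalFunctions σ} {a : F} {P Q : MvPolynomial σ ℕ}
    (h : IsExpression g u a P Q) : IsExpression g u⁻¹ a⁻¹ Q P := by
  refine ⟨h.num_ne_zero, ?_, ?_⟩
  · rw [← h.2.1, inv_mul_cancel_left₀ h.ne_zero]
  · rw [← h.2.2, ← mul_assoc, ← WithZero.coe_mul, inv_mul_cancel, WithZero.coe_one, one_mul]

variable (g)

/-- The pairs that consist of a rational function with a subtraction-free expression and of its
value at `g`. -/
def valueSubgroup : Subgroup ((RationalFunctions σ)ˣ × F) where
  carrier := {p | ∃ P Q, IsExpression g (p.1 : RationalFunctions σ) p.2 P Q}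
  mul_mem' := by
    rintro _ _ ⟨P, Q, h⟩ ⟨P', Q', h'⟩
    exact ⟨_, _, by simpa using h.mul h'⟩
  one_mem' := ⟨1, 1, by simp [IsExpression]⟩
  inv_mem' := by
    rintro _ ⟨P, Q, h⟩
    exact ⟨_, _, by simpa using h.inv⟩

noncomputable instance : Add (valueSubgroup g) where
  add p q := ⟨(Units.mk0 ((p.1.1 : RationalFunctions σ) + q.1.1) (by
      obtain ⟨P, Q, h⟩ := p.2
      obtain ⟨P', Q', h'⟩ := q.2
      exact (h.add h').ne_zero), p.1.2 + q.1.2), by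
    obtain ⟨P, Q, h⟩ := p.2
    obtain ⟨P', Q', h'⟩ := q.2
    exact ⟨_, _, h.add h'⟩⟩

/-- The rational function of a pair. -/
noncomputable def valueSubgroup.toRatFunc : valueSubgroup g →* RationalFunctions σ :=
  ((Units.coeHom _).comp (MonoidHom.fst _ _)).comp (valueSubgroup g).subtype

/-- The value of a pair. -/
noncomputable def valueSubgroup.value : valueSubgroup g →* F :=
  (MonoidHom.snd _ _).comp (valueSubgroup g).subtype

theorem valueSubgroup.toRatFunc_add (p q : valueSubgroup g) :
    toRatFunc g (p + q) = toRatFunc g p + toRatFunc g q := rfl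

theorem valueSubgroup.value_add (p q : valueSubgroup g) :
    value g (p + q) = value g p + value g q := rfl

/-- The second component of a pair is determined by the first, because the value of a
subtraction-free function is well defined. -/
theorem valueSubgroup.toRatFunc_injective : Function.Injective (toRatFunc g) := by
  rintro ⟨⟨u, a⟩, P, Q, h⟩ ⟨⟨w, b⟩, P', Q', h'⟩ e
  obtain rfl : u = w := Units.ext e
  obtain rfl : a = b := h.unique h'
  rfl

-- The axioms are inherited from the field of rational functions along the injection `toRatFunc`.
open valueSubgroup in
noncomputable instance : PosSemifield (valueSubgroup g) where
  __ := (inferInstance : CommGroup (valueSubgroup g))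
  __ := (inferInstance : Add (valueSubgroup g))
  add_assoc a b c := toRatFunc_injective g (by simp only [toRatFunc_add]; ring)
  add_comm a b := toRatFunc_injective g (by simp only [toRatFunc_add]; ring)
  left_distrib a b c := toRatFunc_injective g (by simp only [toRatFunc_add, map_mul]; ring)
  right_distrib a b c := toRatFunc_injective g (by simp only [toRatFunc_add, map_mul]; ring)

/-- The coordinate functions, with the values of `g`. -/
noncomputable def valueSubgroup.coord (i : σ) : valueSubgroup g :=
  ⟨(Units.mk0 (toRat σ (MvPolynomial.X i))
      (toRat_ne_zero (g := g) (by simp [evalAt])), g i),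
    MvPolynomial.X i, 1, by simp [IsExpression, evalAt]⟩

end Universal

/-! ### Solutions and semifield homomorphisms -/

section Map

variable {F R : Type*} [PosSemifield F] [PosSemifield R] (π : R →* F)

theorem IsRecurrent.map (hadd : ∀ a b, π (a + b) = π a + π b) {n : ℤ} {I J : Set ℝ}
    {A : Set (ℝ × ℝ × ℝ)} {f : State n A R} (hf : IsRecurrent n I J A f) :
    IsRecurrent n I J A (fun p => π (f p)) := by
  refine ⟨?_, ?_, ?_, ?_⟩
  · intro x y t hI hJ hu hd hx hx' hy hy'
    simp only [hf.inner x y t hI hJ hu hd hx hx' hy hy', map_div, map_mul, hadd]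
  · intro x y t hI hJ hu hd hx hx'
    simp only [hf.wall_y x y t hI hJ hu hd hx hx', map_div, map_mul]
  · intro x y t hI hJ hu hd hy hy'
    simp only [hf.wall_x x y t hI hJ hu hd hy hy', map_div, map_mul]
  · intro x y t σ τ hI hJ hσ hτ hxI hyJ hu hd hx hy
    simp only [hf.corner x y t σ τ hI hJ hσ hτ hxI hyJ hu hd hx hy, map_div, map_mul]

/-- The image of a solution is a solution with the image initial state, so it is the chosen one by
uniqueness. -/
theorem WellPosed.choose_map (hadd : ∀ a b, π (a + b) = π a + π b) {n : ℤ} {I J : Set ℝ}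
    {A S : Set (ℝ × ℝ × ℝ)} {hS : S ⊆ A} (h : WellPosed n I J hS F) (h' : WellPosed n I J hS R)
    (g : State n S R) (p : ↥(A ∩ lattice n)) :
    (h fun q => π (g q)).choose p = π ((h' g).choose p) := by
  have h1 := (h' g).choose_spec.1
  exact (congrFun ((h fun q => π (g q)).choose_spec.2 _
    ⟨h1.1.map π hadd, funext fun q => congrArg π (congrFun h1.2 q)⟩) p).symm

end Map

/-! ### From states on lattice points to functions of natural number coordinates -/

section Coordinates

variable {R K : Type*} [PosSemifield R] [Field K] (ν : R →* K)

open Classical in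
/-- A state with values in a field, extended by one to all points. -/
noncomputable def extendOne {n : ℤ} {A : Set (ℝ × ℝ × ℝ)} (f : State n A R) (p : ℝ × ℝ × ℝ) : K :=
  if h : p ∈ A ∩ lattice n then ν (f ⟨p, h⟩) else 1

theorem extendOne_of_mem {n : ℤ} {A : Set (ℝ × ℝ × ℝ)} (f : State n A R) {p : ℝ × ℝ × ℝ}
    (h : p ∈ A ∩ lattice n) : extendOne ν f p = ν (f ⟨p, h⟩) :=
  dif_pos h

/-- The default value one keeps this true outside `A`, so that the field arguments may assume
nonvanishing at all indices. -/
theorem extendOne_ne_zero {n : ℤ} {A : Set (ℝ × ℝ × ℝ)} (f : State n A R) (p : ℝ × ℝ × ℝ) :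
    extendOne ν f p ≠ 0 := by
  rw [extendOne]
  split_ifs
  · exact ((Group.isUnit _).map ν).ne_zero
  · exact one_ne_zero

variable {n : ℤ} {I J : Set ℝ} {A : Set (ℝ × ℝ × ℝ)} {f : State n A R}

theorem map_div_mul_cancel (a b : R) : ν (a / b) * ν b = ν a := by
  rw [← map_mul, div_mul_cancel]

/-- The points are separate variables tied by equations, so that membership can be checked in the
integer coordinates and the geometry by `ring`. -/
theorem IsRecurrent.extendOne_inner (hf : IsRecurrent n I J A f)
    (hadd : ∀ a b, ν (a + b) = ν a + ν b) {x y t : ℝ} (hI : x ∈ interior I) (hJ : y ∈ interior J)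
    {u d e w k l : ℝ × ℝ × ℝ} (hu : u ∈ A ∩ lattice n) (hd : d ∈ A ∩ lattice n)
    (he : e ∈ A ∩ lattice n) (hw : w ∈ A ∩ lattice n) (hk : k ∈ A ∩ lattice n)
    (hl : l ∈ A ∩ lattice n) (eu : u = (x, y, t + 1)) (ed : d = (x, y, t - 1))
    (ee : e = (x + 1, y, t)) (ew : w = (x - 1, y, t)) (ek : k = (x, y + 1, t))
    (el : l = (x, y - 1, t)) :
    extendOne ν f u * extendOne ν f d = extendOne ν f e * extendOne ν f w +
      extendOne ν f k * extendOne ν f l := by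
  subst eu ed ee ew ek el
  rw [extendOne_of_mem ν f hu, extendOne_of_mem ν f hd, extendOne_of_mem ν f he,
    extendOne_of_mem ν f hw, extendOne_of_mem ν f hk, extendOne_of_mem ν f hl,
    hf.inner x y t hI hJ hu hd he hw hk hl, map_div_mul_cancel, hadd, map_mul, map_mul]

theorem IsRecurrent.extendOne_wall_y (hf : IsRecurrent n I J A f)
    {x y t : ℝ} (hI : x ∈ interior I) (hJ : y ∈ J \ interior J)
    {u d e w : ℝ × ℝ × ℝ} (hu : u ∈ A ∩ lattice n) (hd : d ∈ A ∩ lattice n)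
    (he : e ∈ A ∩ lattice n) (hw : w ∈ A ∩ lattice n)
    (eu : u = (x, y, t + 1)) (ed : d = (x, y, t - 1))
    (ee : e = (x + 1, y, t)) (ew : w = (x - 1, y, t)) :
    extendOne ν f u * extendOne ν f d = extendOne ν f e * extendOne ν f w := by
  subst eu ed ee ew
  rw [extendOne_of_mem ν f hu, extendOne_of_mem ν f hd, extendOne_of_mem ν f he,
    extendOne_of_mem ν f hw, hf.wall_y x y t hI hJ hu hd he hw, map_div_mul_cancel, map_mul]

theorem IsRecurrent.extendOne_wall_x (hf : IsRecurrent n I J A f)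
    {x y t : ℝ} (hI : x ∈ I \ interior I) (hJ : y ∈ interior J)
    {u d k l : ℝ × ℝ × ℝ} (hu : u ∈ A ∩ lattice n) (hd : d ∈ A ∩ lattice n)
    (hk : k ∈ A ∩ lattice n) (hl : l ∈ A ∩ lattice n)
    (eu : u = (x, y, t + 1)) (ed : d = (x, y, t - 1))
    (ek : k = (x, y + 1, t)) (el : l = (x, y - 1, t)) :
    extendOne ν f u * extendOne ν f d = extendOne ν f k * extendOne ν f l := by
  subst eu ed ek el
  rw [extendOne_of_mem ν f hu, extendOne_of_mem ν f hd, extendOne_of_mem ν f hk,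
    extendOne_of_mem ν f hl, hf.wall_x x y t hI hJ hu hd hk hl, map_div_mul_cancel, map_mul]

theorem IsRecurrent.extendOne_corner (hf : IsRecurrent n I J A f)
    {x y t : ℝ} (σ τ : ℝ) (hI : x ∈ I \ interior I) (hJ : y ∈ J \ interior J)
    (hσ : σ = 1 ∨ σ = -1) (hτ : τ = 1 ∨ τ = -1) (hσI : x + σ ∈ I) (hτJ : y + τ ∈ J)
    {u d e k : ℝ × ℝ × ℝ} (hu : u ∈ A ∩ lattice n) (hd : d ∈ A ∩ lattice n)
    (he : e ∈ A ∩ lattice n) (hk : k ∈ A ∩ lattice n)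
    (eu : u = (x, y, t + 1)) (ed : d = (x, y, t - 1))
    (ee : e = (x + σ, y, t)) (ek : k = (x, y + τ, t)) :
    extendOne ν f u * extendOne ν f d = extendOne ν f e * extendOne ν f k := by
  subst eu ed ee ek
  rw [extendOne_of_mem ν f hu, extendOne_of_mem ν f hd, extendOne_of_mem ν f he,
    extendOne_of_mem ν f hk, hf.corner x y t σ τ hI hJ hσ hτ hσI hτJ hu hd he hk,
    map_div_mul_cancel, map_mul]

/-- The point of `A₁` with the coordinates `i = (n + x + t - y) / 2`, `j = (n + x - t - y) / 2`
and `y`. -/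
def halfOctPoint (n i j y : ℕ) : ℝ × ℝ × ℝ := ((i : ℝ) + j + y - n, (y : ℝ), (i : ℝ) - j)

/-- The point of `A₂` with the coordinates `x`, `y` and `a = (n + t - x - y) / 2`. -/
def prismPoint (n x y a : ℕ) : ℝ × ℝ × ℝ := ((x : ℝ), (y : ℝ), (x : ℝ) + y + 2 * a - n)

theorem halfOctPoint_mem_lattice (n i j y : ℕ) : halfOctPoint n i j y ∈ lattice n :=
  ⟨i + j + y - n, y, i - j, by simp [halfOctPoint], ⟨i + y - n, by ring⟩⟩

theorem prismPoint_mem_lattice (n x y a : ℕ) : prismPoint n x y a ∈ lattice n :=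
  ⟨x, y, x + y + 2 * a - n, by simp [prismPoint], ⟨x + y + a - n, by ring⟩⟩

theorem halfOctPoint_mem {n i j y : ℕ} (hi : i + y ≤ n) (hj : j + y ≤ n) :
    halfOctPoint n i j y ∈ A₁ n ∩ lattice n := by
  refine ⟨?_, halfOctPoint_mem_lattice n i j y⟩
  rw [halfOctPoint, mem_A₁]
  have h1 : (i : ℝ) + y ≤ n := by exact_mod_cast hi
  have h2 : (j : ℝ) + y ≤ n := by exact_mod_cast hj
  have h3 : (0 : ℝ) ≤ i := i.cast_nonneg
  have h4 : (0 : ℝ) ≤ j := j.cast_nonneg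
  exact ⟨y.cast_nonneg, by linarith, by linarith, by linarith, by linarith⟩

theorem prismPoint_mem {n x y a : ℕ} (hx : x + a ≤ n) (hy : y ≤ n) :
    prismPoint n x y a ∈ A₂ n ∩ lattice n := by
  refine ⟨?_, prismPoint_mem_lattice n x y a⟩
  rw [prismPoint, mem_A₂]
  have h1 : (x : ℝ) + a ≤ n := by exact_mod_cast hx
  have h2 : (y : ℝ) ≤ n := by exact_mod_cast hy
  have h3 : (0 : ℝ) ≤ a := a.cast_nonneg
  exact ⟨x.cast_nonneg, y.cast_nonneg, h2, by linarith, by linarith⟩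

theorem isHalfOctSolution_of_isRecurrent {n : ℕ} {f : State n (A₁ n) R}
    (hadd : ∀ a b, ν (a + b) = ν a + ν b) (hf : IsRecurrent (n : ℤ) Set.univ (Set.Ici 0) (A₁ n) f) :
    IsHalfOctSolution n fun i j y => extendOne ν f (halfOctPoint n i j y) := by
  refine ⟨fun i j y hi hj => ?_, fun i j hi hj => ?_⟩
  · have h := hf.extendOne_inner ν hadd (x := (i : ℝ) + j + y + 2 - n) (y := (y : ℝ) + 1)
      (t := (i : ℝ) - j) (by simp) (by rw [interior_Ici]; exact Nat.cast_add_one_pos (α := ℝ) y)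
      (halfOctPoint_mem (i := i + 1) (j := j) (y := y + 1) (by omega) (by omega))
      (halfOctPoint_mem (i := i) (j := j + 1) (y := y + 1) (by omega) (by omega))
      (halfOctPoint_mem (i := i + 1) (j := j + 1) (y := y + 1) (by omega) (by omega))
      (halfOctPoint_mem (i := i) (j := j) (y := y + 1) (by omega) (by omega))
      (halfOctPoint_mem (i := i) (j := j) (y := y + 2) (by omega) (by omega))
      (halfOctPoint_mem (i := i + 1) (j := j + 1) (y := y) (by omega) (by omega))
      (by ext <;> simp only [halfOctPoint] <;> push_cast <;> ring)
      (by ext <;> simp only [halfOctPoint] <;> push_cast <;> ring)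
      (by ext <;> simp only [halfOctPoint] <;> push_cast <;> ring)
      (by ext <;> simp only [halfOctPoint] <;> push_cast <;> ring)
      (by ext <;> simp only [halfOctPoint] <;> push_cast <;> ring)
      (by ext <;> simp only [halfOctPoint] <;> push_cast <;> ring)
    rw [h, mul_comm (extendOne ν f (halfOctPoint n i j (y + 1)))]
  · have h := hf.extendOne_wall_y ν (x := (i : ℝ) + j + 1 - n) (y := 0)
      (t := (i : ℝ) - j) (by simp) (by simp)
      (halfOctPoint_mem (i := i + 1) (j := j) (y := 0) (by omega) (by omega))
      (halfOctPoint_mem (i := i) (j := j + 1) (y := 0) (by omega) (by omega))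
      (halfOctPoint_mem (i := i + 1) (j := j + 1) (y := 0) (by omega) (by omega))
      (halfOctPoint_mem (i := i) (j := j) (y := 0) (by omega) (by omega))
      (by ext <;> simp only [halfOctPoint] <;> push_cast <;> ring)
      (by ext <;> simp only [halfOctPoint] <;> push_cast <;> ring)
      (by ext <;> simp only [halfOctPoint] <;> push_cast <;> ring)
      (by ext <;> simp only [halfOctPoint] <;> push_cast <;> ring)
    rw [h, mul_comm]

theorem isPrismSolution_of_isRecurrent {n : ℕ} (hn : 0 < n) {f : State n (A₂ n) R}
    (hadd : ∀ a b, ν (a + b) = ν a + ν b)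
    (hf : IsRecurrent (n : ℤ) (Set.Ici 0) (Set.Icc 0 (n : ℝ)) (A₂ n) f) :
    IsPrismSolution n fun x y a => extendOne ν f (prismPoint n x y a) := by
  have hI : ∀ x : ℕ, (x : ℝ) + 1 ∈ interior (Set.Ici (0 : ℝ)) := fun x => by
    rw [interior_Ici]
    exact Nat.cast_add_one_pos (α := ℝ) x
  have hI0 : (0 : ℝ) ∈ Set.Ici (0 : ℝ) \ interior (Set.Ici 0) := by simp
  have hJ : ∀ y : ℕ, y + 2 ≤ n → (y : ℝ) + 1 ∈ interior (Set.Icc (0 : ℝ) n) := fun y hy => by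
    rw [interior_Icc]
    exact ⟨Nat.cast_add_one_pos (α := ℝ) y, by exact_mod_cast (show y + 1 < n by omega)⟩
  have hJ0 : (0 : ℝ) ∈ Set.Icc (0 : ℝ) n \ interior (Set.Icc (0 : ℝ) n) := by simp
  have hJn : (n : ℝ) ∈ Set.Icc (0 : ℝ) n \ interior (Set.Icc (0 : ℝ) n) := by simp
  have hn1 : (1 : ℝ) ≤ n := by exact_mod_cast hn
  refine ⟨fun x y a hx hy => ?_, fun x a hx => ?_, fun x a hx => ?_, fun y a ha hy => ?_,
    fun a ha => ?_, fun a ha => ?_⟩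
  · exact hf.extendOne_inner ν hadd (t := (x : ℝ) + y + 2 * a + 3 - n) (hI x) (hJ y hy)
      (prismPoint_mem (by omega) (by omega)) (prismPoint_mem (by omega) (by omega))
      (prismPoint_mem (by omega) (by omega)) (prismPoint_mem (by omega) (by omega))
      (prismPoint_mem (by omega) (by omega)) (prismPoint_mem (by omega) (by omega))
      (by ext <;> simp only [prismPoint] <;> push_cast <;> ring)
      (by ext <;> simp only [prismPoint] <;> push_cast <;> ring)
      (by ext <;> simp only [prismPoint] <;> push_cast <;> ring)
      (by ext <;> simp only [prismPoint] <;> push_cast <;> ring)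
      (by ext <;> simp only [prismPoint] <;> push_cast <;> ring)
      (by ext <;> simp only [prismPoint] <;> push_cast <;> ring)
  · exact hf.extendOne_wall_y ν (t := (x : ℝ) + 2 * a + 2 - n) (hI x) hJ0
      (prismPoint_mem (by omega) (by omega)) (prismPoint_mem (by omega) (by omega))
      (prismPoint_mem (by omega) (by omega)) (prismPoint_mem (by omega) (by omega))
      (by ext <;> simp only [prismPoint] <;> push_cast <;> ring)
      (by ext <;> simp only [prismPoint] <;> push_cast <;> ring)
      (by ext <;> simp only [prismPoint] <;> push_cast <;> ring)
      (by ext <;> simp only [prismPoint] <;> push_cast <;> ring)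
  · exact hf.extendOne_wall_y ν (t := (x : ℝ) + 2 * a + 2) (hI x) hJn
      (prismPoint_mem (by omega) (by omega)) (prismPoint_mem (by omega) (by omega))
      (prismPoint_mem (by omega) (by omega)) (prismPoint_mem (by omega) (by omega))
      (by ext <;> simp only [prismPoint] <;> push_cast <;> ring)
      (by ext <;> simp only [prismPoint] <;> push_cast <;> ring)
      (by ext <;> simp only [prismPoint] <;> push_cast <;> ring)
      (by ext <;> simp only [prismPoint] <;> push_cast <;> ring)
  · exact hf.extendOne_wall_x ν (t := (y : ℝ) + 2 * a + 2 - n) hI0 (hJ y hy)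
      (prismPoint_mem (by omega) (by omega)) (prismPoint_mem (by omega) (by omega))
      (prismPoint_mem (by omega) (by omega)) (prismPoint_mem (by omega) (by omega))
      (by ext <;> simp only [prismPoint] <;> push_cast <;> ring)
      (by ext <;> simp only [prismPoint] <;> push_cast <;> ring)
      (by ext <;> simp only [prismPoint] <;> push_cast <;> ring)
      (by ext <;> simp only [prismPoint] <;> push_cast <;> ring)
  · exact hf.extendOne_corner ν (t := 2 * (a : ℝ) + 1 - n) 1 1 hI0 hJ0 (Or.inl rfl) (Or.inl rfl)
      (by simp) (by simpa using hn1)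
      (prismPoint_mem (by omega) (by omega)) (prismPoint_mem (by omega) (by omega))
      (prismPoint_mem (by omega) (by omega)) (prismPoint_mem (by omega) (by omega))
      (by ext <;> simp only [prismPoint] <;> push_cast <;> ring)
      (by ext <;> simp only [prismPoint] <;> push_cast <;> ring)
      (by ext <;> simp only [prismPoint] <;> push_cast <;> ring)
      (by ext <;> simp only [prismPoint] <;> push_cast <;> ring)
  -- This removes the truncated subtraction in the neighbour `n - 1`.
  · obtain ⟨m, rfl⟩ : ∃ m, n = m + 1 := ⟨n - 1, by omega⟩
    exact hf.extendOne_corner ν (t := 2 * (a : ℝ) + 1) 1 (-1) hI0 hJn (Or.inl rfl) (Or.inr rfl)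
      (by simp) ⟨by linarith, by linarith⟩
      (prismPoint_mem (by omega) (by omega)) (prismPoint_mem (by omega) (by omega))
      (prismPoint_mem (by omega) (by omega)) (prismPoint_mem (by omega) (by omega))
      (by ext <;> simp only [prismPoint] <;> push_cast <;> ring)
      (by ext <;> simp only [prismPoint] <;> push_cast <;> ring)
      (by ext <;> simp only [prismPoint] <;> push_cast <;> ring)
      (by ext <;> simp only [prismPoint, Nat.add_sub_cancel] <;> push_cast <;> ring)

end Coordinates

/-! ### Matching the boundaries and descending to an arbitrary semifield -/

section Equivalence

theorem sFun_halfOctPoint_left {n x y : ℕ} (h : x + y ≤ n) :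
    halfOctPoint n 0 x y ∈ S₁ n ∧ sFun (halfOctPoint n 0 x y) = prismPoint n x y 0 := by
  have h' : (x : ℝ) + y ≤ n := by exact_mod_cast h
  have hx : ((0 : ℕ) : ℝ) + x + y - n ≤ 0 := by
    push_cast
    linarith
  constructor
  · rw [halfOctPoint, mem_S₁, abs_of_nonpos hx]
    push_cast
    exact ⟨y.cast_nonneg, by simp, by ring⟩
  · rw [halfOctPoint, sFun_of_nonpos hx]
    ext <;> simp only [prismPoint] <;> push_cast <;> ring

theorem sFun_halfOctPoint_right {n x y i : ℕ} (hx : x ≤ n) (hy : y ≤ n) (h : x + y = n + i) :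
    halfOctPoint n i x (n - x) ∈ S₁ n ∧ sFun (halfOctPoint n i x (n - x)) = prismPoint n x y 0 := by
  have h' : (x : ℝ) + y = n + i := by exact_mod_cast h
  have hx' : (x : ℝ) ≤ n := by exact_mod_cast hx
  have hy' : (y : ℝ) ≤ n := by exact_mod_cast hy
  have e : (i : ℝ) + x + ((n - x : ℕ) : ℝ) - n = i := by
    rw [Nat.cast_sub hx]
    ring
  constructor
  · rw [halfOctPoint, mem_S₁, e, abs_of_nonneg i.cast_nonneg]
    exact ⟨Nat.cast_nonneg _, by linarith, by linarith⟩
  · rw [halfOctPoint, e, sFun_of_nonneg i.cast_nonneg, Nat.cast_sub hx]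
    ext <;> simp only [prismPoint] <;> push_cast <;> linarith

theorem exists_halfOctPoint_eq {n : ℕ} {p : ℝ × ℝ × ℝ} (hp : p ∈ S₁' n ∩ lattice n) :
    (∃ x y : ℕ, x ≤ y ∧ y ≤ n ∧ p = halfOctPoint n y (y - x) (n - y) ∧
      sFun' p = prismPoint n x y (n - x)) ∨
    ∃ x y : ℕ, y ≤ x ∧ x ≤ n ∧ p = halfOctPoint n y 0 (n - x) ∧
      sFun' p = prismPoint n x y (n - x) := by
  obtain ⟨h, x, y, t, rfl, -⟩ := hp
  rw [mem_S₁'] at h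
  norm_cast at h
  obtain ⟨hy, ht, h⟩ := h
  rcases le_total 0 x with hx | hx
  · left
    rw [abs_of_nonneg hx] at h
    lift x to ℕ using hx
    lift y to ℕ using hy
    lift t to ℕ using ht
    obtain rfl : x + y + t = n := by exact_mod_cast h
    refine ⟨t, x + t, by omega, by omega, ?_, ?_⟩
    · rw [show x + y + t - (x + t) = y by omega, show x + t - t = x by omega]
      ext <;> simp only [halfOctPoint] <;> push_cast <;> ring
    · rw [sFun'_of_nonneg (by simp), show x + y + t - t = x + y by omega]
      ext <;> simp only [prismPoint] <;> push_cast <;> ring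
  · right
    rw [abs_of_nonpos hx] at h
    obtain ⟨z, rfl⟩ : ∃ z : ℕ, x = -z := ⟨x.natAbs, by omega⟩
    lift y to ℕ using hy
    lift t to ℕ using ht
    rw [neg_neg] at h
    obtain rfl : z + y + t = n := by exact_mod_cast h
    refine ⟨z + t, t, by omega, by omega, ?_, ?_⟩
    · rw [show z + y + t - (z + t) = y by omega]
      ext <;> simp only [halfOctPoint] <;> push_cast <;> ring
    · rw [sFun'_of_nonpos (by simp), show z + y + t - (z + t) = y by omega]
      ext <;> simp only [prismPoint] <;> push_cast <;> ring

/-- The equivalence of the two recurrences, with an explicit scaling factor, for semifields that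
embed into a field. -/
theorem upper_eq_of_embedding {R K : Type*} [PosSemifield R] [Field K] (ν : R →* K)
    (hadd : ∀ a b, ν (a + b) = ν a + ν b) (hinj : Function.Injective ν) {n : ℕ} (hn : 0 < n)
    {f₁ : State n (A₁ n) R} {f₂ : State n (A₂ n) R}
    (h₁ : IsRecurrent (n : ℤ) Set.univ (Set.Ici 0) (A₁ n) f₁)
    (h₂ : IsRecurrent (n : ℤ) (Set.Ici 0) (Set.Icc 0 (n : ℝ)) (A₂ n) f₂)
    (hlow : pullback (s n) (s_lattice n) (restrict (S₂_subset n) f₂) =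
      restrict (S₁_subset n) f₁) (p : ↥(S₁' n ∩ lattice n)) :
    pullback (s' n) (s'_lattice n) (restrict (S₂'_subset n) f₂) p *
        f₁ ⟨halfOctPoint n 0 0 0, halfOctPoint_mem (by omega) (by omega)⟩ =
      restrict (S₁'_subset n) f₁ p *
        f₁ ⟨halfOctPoint n 0 n 0, halfOctPoint_mem (by omega) (by omega)⟩ := by
  -- In coordinates, `s` becomes the index changes of `LowerMatch` and `s'` those of `UpperMatch`.
  have low : ∀ q ∈ S₁ n ∩ lattice n, extendOne ν f₂ (sFun q) = extendOne ν f₁ q := by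
    intro q hq
    have h := congrArg ν (congrFun hlow ⟨q, hq⟩)
    have hq' : sFun q ∈ A₂ n ∩ lattice n :=
      ⟨S₂_subset n (s n ⟨q, hq.1⟩).2, s_lattice n ⟨q, hq.1⟩ hq.2⟩
    rw [extendOne_of_mem ν f₂ hq', extendOne_of_mem ν f₁ (Set.mem_inter (S₁_subset n hq.1) hq.2)]
    exact h
  have key := upperMatch_of_lowerMatch hn (isHalfOctSolution_of_isRecurrent ν hadd h₁)
    (isPrismSolution_of_isRecurrent ν hn hadd h₂) (fun i j y => extendOne_ne_zero ν f₁ _)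
    (fun x y a => extendOne_ne_zero ν f₂ _)
    ⟨fun x y h => by
      obtain ⟨a, b⟩ := sFun_halfOctPoint_left h
      rw [← b, low _ ⟨a, halfOctPoint_mem_lattice n _ _ _⟩],
    fun x y i hx hy h => by
      obtain ⟨a, b⟩ := sFun_halfOctPoint_right hx hy h
      rw [← b, low _ ⟨a, halfOctPoint_mem_lattice n _ _ _⟩]⟩
  have up : extendOne ν f₂ (sFun' p) * extendOne ν f₁ (halfOctPoint n 0 0 0) =
      extendOne ν f₁ p * extendOne ν f₁ (halfOctPoint n 0 n 0) := by
    rcases exists_halfOctPoint_eq p.2 with ⟨x, y, hxy, hy, e, e'⟩ | ⟨x, y, hxy, hx, e, e'⟩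
    · rw [e', e]
      exact key.right x y hxy hy
    · rw [e', e]
      exact key.left x y hxy hx
  have hp' : sFun' p ∈ A₂ n ∩ lattice n :=
    ⟨S₂'_subset n (s' n ⟨p, p.2.1⟩).2, s'_lattice n ⟨p, p.2.1⟩ p.2.2⟩
  rw [extendOne_of_mem ν f₂ hp', extendOne_of_mem ν f₁ (halfOctPoint_mem (by omega) (by omega)),
    extendOne_of_mem ν f₁ (halfOctPoint_mem (by omega) (by omega)),
    extendOne_of_mem ν f₁ (Set.mem_inter (S₁'_subset n p.2.1) p.2.2), ← map_mul, ← map_mul] at up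
  exact hinj up

/-- The equivalence of the two recurrences, with an explicit scaling factor. -/
theorem upper_eq {F : Type*} [PosSemifield F] {n : ℕ} (hn : 0 < n) (g : State n (S₂ n) F)
    (p : ↥(S₁' n ∩ lattice n)) :
    pullback (s' n) (s'_lattice n) (evolution (S₂'_subset n) (wellPosed₂ n F) g) p *
        (wellPosed₁ n F (pullback (s n) (s_lattice n) g)).choose
          ⟨halfOctPoint n 0 0 0, halfOctPoint_mem (by omega) (by omega)⟩ =
      evolution (S₁'_subset n) (wellPosed₁ n F) (pullback (s n) (s_lattice n) g) p *
        (wellPosed₁ n F (pullback (s n) (s_lattice n) g)).choose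
          ⟨halfOctPoint n 0 n 0, halfOctPoint_mem (by omega) (by omega)⟩ := by
  -- The generic state, whose value at each lattice point is an independent variable; it specializes
  -- to `g` under `valueSubgroup.value g`.
  set G : State n (S₂ n) (valueSubgroup g) := valueSubgroup.coord g with hG
  have c₂ := (wellPosed₂ n (valueSubgroup g) G).choose_spec.1
  have c₁ := (wellPosed₁ n (valueSubgroup g) (pullback (s n) (s_lattice n) G)).choose_spec.1
  have m₂ := WellPosed.choose_map (valueSubgroup.value g) (valueSubgroup.value_add g)
    (wellPosed₂ n F) (wellPosed₂ n (valueSubgroup g)) G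
  have m₁ := WellPosed.choose_map (valueSubgroup.value g) (valueSubgroup.value_add g)
    (wellPosed₁ n F) (wellPosed₁ n (valueSubgroup g)) (pullback (s n) (s_lattice n) G)
  have key := congrArg (valueSubgroup.value g) (upper_eq_of_embedding
    (valueSubgroup.toRatFunc g) (valueSubgroup.toRatFunc_add g)
    (valueSubgroup.toRatFunc_injective g) hn c₁.1 c₂.1 (by rw [c₁.2, c₂.2]) p)
  rw [map_mul, map_mul, ← m₁, ← m₁] at key
  simp only [pullback, restrict, ← m₂, ← m₁] at key
  exact key

end Equivalence

end OctRec

/-- The recurrences in the half-octahedron `A₁` and in the domain `A₂` are equivalent up to scaling: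
`s'* ∘ φ̄₂ = φ̄₁ ∘ s*` as maps from the projectivized states of `S₂` to those of `S₁'`. -/
theorem mainTheorem4 (n : ℕ) (hn : 0 < n) (F : Type*) [OctRec.PosSemifield F] :
    OctRec.sPull' n F ∘ OctRec.projPhi₂ n F = OctRec.projPhi₁ n F ∘ OctRec.sPull n F := by
  funext q
  induction q using Quotient.ind with
  | _ g =>
    refine Quotient.sound ?_
    have h := OctRec.upper_eq hn g
    generalize (OctRec.wellPosed₁ n F _).choose ⟨OctRec.halfOctPoint n 0 0 0, _⟩ = a at h
    generalize (OctRec.wellPosed₁ n F _).choose ⟨OctRec.halfOctPoint n 0 n 0, _⟩ = b at h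
    -- `a` and `b` are the initial values of the state on `S₁` at `(-n, 0, 0)` and `(0, 0, -n)`.
    refine ⟨b / a, funext fun p => ?_⟩
    change b / a * _ = _
    rw [div_mul_eq_mul_div, div_eq_iff_eq_mul, mul_comm b]
    exact (h p).symm
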